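/- Let $\mathbb C_n\subset\{0,1\}^{n\times n}$ be the set of matrices of permutations of $[n]$ that consist of one cycle through all $n$ nodes (tours). An instance is a matrix $E\in\mathbb R^{n\times n}$, and the cost of $\Pi\in\mathbb C_n$ is $L(\Pi;E)=\sum_{i,j}E_{ij}M_{ij}\Pi_{ij}$, where $M\in\mathbb R^{n\times n}$ is a fixed (unknown) weight matrix. For $W\in\mathbb R^{n^2\times n^2}$ let $\phi(\Pi;E;W)\propto\exp\big((E^\flat)^\top W\,\Pi^\flat\big)$ be the Gibbs measure on $\mathbb C_n$ ($\flat$ denotes flattening), and for $\beta,\rho\in(0,1)$ put $p(W)=(1-\beta)\,\phi(W)+\beta\,\phi(\rho W)$. For a probability measure (prior) $\mathcal R$ on instances let $$\mathcal L(W)=\mathbf E_{E\sim\mathcal R}\,\mathbf E_{\Pi\sim p(\cdot;E;W)}[L(\Pi;E)],\qquad \mathrm{opt}=\mathbf E_{E\sim\mathcal R}\Big[\min_{\Pi\in\mathbb C_n}L(\Pi;E)\Big],$$ $$H(W)=\mathbf E_{E\sim\mathcal R}\,\mathbf E_{\Pi\sim\phi(\cdot;E;W)}[\log\phi(\Pi;E;W)],\qquad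 R(W)=(1-\beta)H(W)+\tfrac{\beta}{\rho}H(\rho W).$$ **Theorem (TSP).** Fix $K\in\mathbb N$ and write $D_n=K(n+1)^K$. There is a constant $c=c(K)$ such that for every $n$ and every $\epsilon>0$ there are rational numbers $\beta,\rho\in(0,1)$ and $B>0$ and a real $\lambda>0$ for which the family $\mathcal P=\{p(W):W\in\mathcal W\}$ with $\mathcal W=\{W:\|W\|_F\le B\}$ satisfies the following. 1. *(Compressed.)* The number of binary digits of (the numerators and denominators of) $\beta,\rho,B$, plus a number $N$ of bits, is at most $c\,(n+1)^c\,(1+\log(1+1/\epsilon))^c$, and $N$ bits suffice to identify the elements of $\mathcal W$ to accuracy $\epsilon$: there is a map $\{0,1\}^N\to\mathcal W$ such that every $W\in\mathcal W$ is within $\epsilon$, in Frobenius norm, of some point $W'$ of its image for which moreover $p(\cdot;E;W)$ and $p(\cdot;E;W')$ are within $\epsilon$ in total variation for every instance with $\|E\|_F\le D_n$. Moreover, for every $M$ with $\|M\|_F\le D_n$ and every prior $\mathcal R$ with $\|E\|_F\le D_n$ almost surely, there is $\overline W\in\mathcal W$ such that: 2. *(Complete.)* $\mathcal L(\overline W)\le\mathrm{opt}+\epsilon$.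 3. *(Efficiently optimizable.)* (a) The policy gradient estimate of $\nabla(\mathcal L+\lambda R)(W)$ draws $E\sim\mathcal R$, then the scale $s=1$ with probability $1-\beta$ or $s=\rho$ with probability $\beta$, then $\Pi\sim\phi(\cdot;E;sW)$, and returns $\big(L(\Pi;E)+\tfrac{\lambda}{s}\log\phi(\Pi;E;sW)\big)\nabla_W\log\phi(\Pi;E;sW)$. It is unbiased for every $W\in\mathcal W$ and its variance on $\mathcal W$ is at most $c\,(n+1)^c(1+1/\epsilon)^c$. (b) For every $V\ge0$ there are a step size $\eta>0$ and an integer $T_0\ge 1$ with $T_0\le c\,(n+1)^c(1+1/\epsilon)^c(1+V)^c$ such that for every unbiased stochastic gradient oracle of $\mathcal L+\lambda R$ with variance at most $V$ on $\mathcal W$, every $W_0\in\mathcal W$ and every $T\ge T_0$, the iterates $W_{t+1}=\mathrm{proj}_{\mathcal W}(W_t-\eta g_t)$ of projected SGD, where $g_t$ is the oracle's answer at $W_t$, satisfy $$\frac1T\sum_{t=1}^T\mathbf E\big[(\mathcal L+\lambda R)(W_t)\big]\le\min_{\mathcal W}(\mathcal L+\lambda R)+\epsilon,\qquad \frac1T\sum_{t=1}^T\mathbf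 E\big[\mathcal L(W_t)\big]\le\mathcal L(\overline W)+\epsilon .$$ In particular, projected SGD with the policy gradient estimates needs $\mathrm{poly}(n,1/\epsilon)$ steps. -/

import Mathlib

open MeasureTheory ProbabilityTheory

noncomputable section

namespace TSPGenerator

/-- Flattened real `n × n` matrices with the Frobenius (Euclidean) norm; used for instances
(weighted adjacency matrices) and for the cost weights. -/
abbrev Mat (n : ℕ) : Type := EuclideanSpace ℝ (Fin n × Fin n)

/-- Parameters: real `n² × n²` matrices with the Frobenius norm. Rows are indexed by the entries of
the instance, columns by the entries of the solution. -/
abbrev Param (n : ℕ) : Type := EuclideanSpace ℝ ((Fin n × Fin n) × (Fin n × Fin n))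

/-- Tours on `n` nodes: permutations consisting of a single cycle through all nodes. -/
def Tour (n : ℕ) : Type := {σ : Equiv.Perm (Fin n) // σ.IsCycleOn Set.univ}

instance (n : ℕ) : Finite (Tour n) :=
  inferInstanceAs (Finite {σ : Equiv.Perm (Fin n) // σ.IsCycleOn Set.univ})

instance (n : ℕ) : Fintype (Tour n) := Fintype.ofFinite _

variable {n : ℕ}

/-- The (flattened) cyclic permutation matrix `Π` of a tour. -/
def tourMatrix (σ : Tour n) : Mat n :=
  WithLp.toLp 2 fun a => (Equiv.Perm.permMatrix ℝ σ.1) a.1 a.2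

/-- The TSP cost `L(Π; E) = ∑ E_ij M_ij Π_ij`. -/
def cost (M E : Mat n) (σ : Tour n) : ℝ := ∑ a, E a * M a * tourMatrix σ a

/-- The bilinear score `zᵀ W x` with `z = E` and `x = Π`. -/
def score (W : Param n) (E : Mat n) (σ : Tour n) : ℝ :=
  ∑ a, ∑ b, E a * W (a, b) * tourMatrix σ b

/-- The Gibbs measure `φ(Π; E; W) ∝ exp (zᵀ W x)` over cyclic permutation matrices. -/
def gibbs (W : Param n) (E : Mat n) (σ : Tour n) : ℝ :=
  Real.exp (score W E σ) / ∑ τ : Tour n, Real.exp (score W E τ)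

/-- The fast/slow solution generator `p(W) = (1 - β) φ(W) + β φ(ρ W)`. -/
def generator (β ρ : ℝ) (W : Param n) (E : Mat n) (σ : Tour n) : ℝ :=
  (1 - β) * gibbs W E σ + β * gibbs (ρ • W) E σ

/-- The loss `𝓛(W)`: expected cost of a generated tour, over the prior `μ` on instances. -/
def loss (μ : Measure (Mat n)) (M : Mat n) (β ρ : ℝ) (W : Param n) : ℝ :=
  ∫ E, ∑ σ : Tour n, generator β ρ W E σ * cost M E σ ∂μ

/-- The expected optimal cost (the infimum is over a finite nonempty set). -/
def opt (μ : Measure (Mat n)) (M : Mat n) : ℝ :=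
  ∫ E, ⨅ σ : Tour n, cost M E σ ∂μ

/-- The negative entropy `H(W)`. -/
def negEntropy (μ : Measure (Mat n)) (W : Param n) : ℝ :=
  ∫ E, ∑ σ : Tour n, gibbs W E σ * Real.log (gibbs W E σ) ∂μ

/-- The regularizer `(1 - β) H(W) + (β / ρ) H(ρ W)`. -/
def regularizer (μ : Measure (Mat n)) (β ρ : ℝ) (W : Param n) : ℝ :=
  (1 - β) * negEntropy μ W + β / ρ * negEntropy μ (ρ • W)

/-- The regularized loss `𝓛 + lam · R`. -/
def regLoss (μ : Measure (Mat n)) (M : Mat n) (β ρ lam : ℝ) (W : Param n) : ℝ :=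
  loss μ M β ρ W + lam * regularizer μ β ρ W

/-- Number of binary digits of the numerator and denominator of a rational. -/
def ratBits (q : ℚ) : ℕ := Nat.size q.num.natAbs + Nat.size q.den

/-- The parameters in the closed ball of radius `B` are identified by strings of `N` bits, to
accuracy `δ`: in Frobenius norm, and in total variation of the generated distributions on every
instance of norm at most `D`. -/
def IdentifiedByBits (n : ℕ) (β ρ B D δ : ℝ) (N : ℕ) : Prop :=
  ∃ dec : (Fin N → Bool) → Param n,
    (∀ b, dec b ∈ Metric.closedBall (0 : Param n) B) ∧
    ∀ W ∈ Metric.closedBall (0 : Param n) B, ∃ b, ‖dec b - W‖ ≤ δ ∧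
      ∀ E : Mat n, ‖E‖ ≤ D →
        (∑ σ : Tour n, |generator β ρ (dec b) E σ - generator β ρ W E σ|) / 2 ≤ δ

open Classical in
/-- The Euclidean projection onto the closed ball of radius `B` around `0`. -/
def projBall (B : ℝ) (W : Param n) : Param n :=
  if ‖W‖ ≤ B then W else (B / ‖W‖) • W

/-- `κ` is a stochastic gradient oracle for `f` on the ball of radius `B` with variance at most
`V`: at each `W` in the ball, a random vector with law `κ W` has finite second moment, its mean is
the gradient of `f` at `W`, and its expected squared distance to the mean is at most `V`. -/
def IsGradientOracle (κ : Kernel (Param n) (Param n)) (f : Param n → ℝ) (B V : ℝ) : Prop :=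
  ∀ W ∈ Metric.closedBall (0 : Param n) B,
    MemLp id 2 (κ W) ∧
    HasGradientAt f (∫ g, g ∂(κ W)) W ∧
    ∫ g, ‖g - ∫ g', g' ∂(κ W)‖ ^ 2 ∂(κ W) ≤ V

/-- The law of the `t`-th iterate of projected SGD, `W ↦ proj (W - η g)` with `g ∼ κ W` drawn
freshly in every step, started at `W₀`. -/
def sgdLaw (κ : Kernel (Param n) (Param n)) (η B : ℝ) (W₀ : Param n) : ℕ → Measure (Param n)
  | 0 => Measure.dirac W₀
  | t + 1 => (sgdLaw κ η B W₀ t).bind fun W => (κ W).map fun g => projBall B (W - η • g)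

/-- The expected value of `f` at a uniformly random iterate among `W₁, …, W_T`. -/
def sgdValue (κ : Kernel (Param n) (Param n)) (η B : ℝ) (W₀ : Param n) (T : ℕ)
    (f : Param n → ℝ) : ℝ :=
  (∑ t ∈ Finset.range T, ∫ W, f W ∂(sgdLaw κ η B W₀ (t + 1))) / T

/-- The policy gradient sample for the mixture component of scale `s` (`s = 1` or `s = ρ`):
`(L(σ; E) + (lam / s) log φ(σ; E; s W)) ∇_W log φ(σ; E; s W)`. -/
def policySample (M : Mat n) (lam s : ℝ) (W : Param n) (E : Mat n) (σ : Tour n) : Param n :=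
  (cost M E σ + lam / s * Real.log (gibbs (s • W) E σ)) •
    gradient (fun W' : Param n => Real.log (gibbs (s • W') E σ)) W

/-- The law of the policy gradient estimate at `W`: draw an instance `E ∼ μ`, then a tour from
`p(·; E; W)` (choose the fast component with probability `1 - β` and the slow one with probability
`β`, then a tour from that component), and return the corresponding policy gradient sample, which
uses one call to the cost oracle. -/
def policyGradientLaw (μ : Measure (Mat n)) (M : Mat n) (β ρ lam : ℝ) (W : Param n) :
    Measure (Param n) :=
  μ.bind fun E => ∑ σ : Tour n,
    (ENNReal.ofReal ((1 - β) * gibbs W E σ) • Measure.dirac (policySample M lam 1 W E σ) +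
      ENNReal.ofReal (β * gibbs (ρ • W) E σ) • Measure.dirac (policySample M lam ρ W E σ))

end TSPGenerator

end

/-! ### Tours under relabelling, and the variance of a linear functional of a uniform tour. -/

noncomputable section

namespace TSPGenerator

open Equiv

/-! The cost is linear in the tour matrix, so on every instance it equals $-\lambda$ times the score
of a single parameter $\overline W$, the diagonal matrix with entries $-M/\lambda$
(`cost_eq_score_optParam`). At scale $s$, expected cost plus $\lambda/s$ times negative entropy is
therefore, up to a term independent of $W$, $(\lambda/s)\,\mathrm{KL}(\phi(sW)\,\|\,\phi(s\overline
W))$ (`scaleObj_sub_opt`). Hence the same $\overline W$ minimizes the fast and the slow component.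
The entropies range over an interval of length $\log\#\mathrm{tours}\le(n+1)^2$, so an inverse
polynomial $\lambda$ makes their influence at most $\epsilon/2$; this gives completeness, and it
transfers bounds from the regularized loss to the loss.

The regularized loss need not be convex, but it is quasar convex around $\overline W$. Let $D$ be
the score of $W-\overline W$ on an instance and $\Delta$ its range over tours. The gradient paired
with $W-\overline W$ is $\lambda s$ times the variance of $D$ under $\phi(sW)$ (`inner_scaleGrad`),
while the suboptimality is at most $\lambda s\Delta^2$ (`scaleObj_sub_opt_le`). The fast component
may concentrate on few tours and have almost no variance. The slow one cannot: for inverse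
polynomial $\rho$ its scores are at most $1/4$, so its probabilities are at least half the uniform
ones. For uniform tours, $\Delta^2$ is at most $4n^8$ times the variance (`sq_tourSum_sub_le`). The
slow gradient alone thus controls the suboptimality of the whole mixture, at a polynomial price
(`regLoss_sub_le`).

The variance bound rests on locality. Exchanging two nodes of a tour changes a linear functional by
an amount that sees at most six labels; all relabellings fixing these labels, a fraction of at least
$n^{-6}$, reproduce the same change. At most $n$ exchanges lead from any tour to any other.

Projected SGD is then analysed with the squared distance to $\overline W$ as potential
(`sgdValue_le`). A grid on the ball gives the description by bits, since nearby parameters have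
nearby Gibbs measures. -/

instance instNonemptyTour (n : ℕ) : Nonempty (Tour n) := by
  -- For $n\le1$ the only permutation counts as a tour, so normalizers and minima make sense for
  -- every $n$.
  rcases Nat.lt_or_ge n 2 with h | h
  · have : Subsingleton (Fin n) := Fin.subsingleton_iff_le_one.2 (by omega)
    exact ⟨⟨1, Perm.isCycleOn_one.2 Set.subsingleton_of_subsingleton⟩⟩
  · have hc := (isCycle_finRotate_of_le h).isCycleOn
    have hs : {x | finRotate n x ≠ x} = Set.univ := by
      have := support_finRotate_of_le h
      ext x
      have hx : x ∈ (finRotate n).support := by simp [this]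
      simpa using hx
    rw [hs] at hc
    exact ⟨⟨_, hc⟩⟩

theorem card_tour_le (n : ℕ) : Fintype.card (Tour n) ≤ n.factorial := by
  have h : Fintype.card (Tour n) ≤ Fintype.card (Perm (Fin n)) :=
    Fintype.card_le_of_injective (fun σ : Tour n => σ.1) Subtype.val_injective
  rwa [Fintype.card_perm, Fintype.card_fin] at h

/-- The crude bound $(n+1)^{n+1}$ suffices: the range of the entropy only has to be polynomial in
$n$. -/
theorem log_card_tour_le (n : ℕ) :
    Real.log (Fintype.card (Tour n)) ≤ ((n : ℝ) + 1) ^ 2 := by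
  have h1 : (Fintype.card (Tour n) : ℝ) ≤ ((n : ℝ) + 1) ^ (n + 1) := by
    have : Fintype.card (Tour n) ≤ (n + 1) ^ (n + 1) :=
      (card_tour_le n).trans ((Nat.factorial_le_pow n).trans
        ((Nat.pow_le_pow_left n.le_succ n).trans (Nat.pow_le_pow_right n.succ_pos n.le_succ)))
    exact_mod_cast this
  have h0 : (0 : ℝ) < Fintype.card (Tour n) := by exact_mod_cast Fintype.card_pos
  calc Real.log (Fintype.card (Tour n)) ≤ Real.log (((n : ℝ) + 1) ^ (n + 1)) :=
        Real.log_le_log h0 h1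
    _ = ((n : ℝ) + 1) * Real.log ((n : ℝ) + 1) := by rw [Real.log_pow]; push_cast; ring
    _ ≤ ((n : ℝ) + 1) * ((n : ℝ) + 1) := by
        gcongr
        exact Real.log_le_self (by positivity)
    _ = _ := by ring

variable {n : ℕ}

/-- Relabelling the nodes of a tour. -/
def Tour.conj (g : Perm (Fin n)) (σ : Tour n) : Tour n :=
  ⟨g * σ.1 * g⁻¹, by simpa using σ.2.conj (g := g)⟩

theorem Tour.conj_mul (g h : Perm (Fin n)) (σ : Tour n) :
    Tour.conj (g * h) σ = Tour.conj g (Tour.conj h σ) :=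
  Subtype.ext (by simp [Tour.conj, mul_assoc])

@[simp] theorem Tour.conj_one (σ : Tour n) : Tour.conj 1 σ = σ :=
  Subtype.ext (by simp [Tour.conj])

/-- Relabelling is a bijection of the tours. -/
def Tour.conjEquiv (g : Perm (Fin n)) : Tour n ≃ Tour n where
  toFun := Tour.conj g
  invFun := Tour.conj g⁻¹
  left_inv σ := by rw [← Tour.conj_mul]; simp
  right_inv σ := by rw [← Tour.conj_mul]; simp

/-- For $n\ge2$ tours are cycles of full support, and cycles with supports of equal size are
conjugate. This transitivity turns averages over tours into averages over relabellings. -/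
theorem Tour.exists_conj (σ τ : Tour n) : ∃ g, Tour.conj g σ = τ := by
  rcases Nat.lt_or_ge n 2 with h | h
  · have : Subsingleton (Fin n) := Fin.subsingleton_iff_le_one.2 (by omega)
    exact ⟨1, Subtype.ext (Subsingleton.elim _ _)⟩
  · have : Nontrivial (Fin n) := Fin.nontrivial_iff_two_le.2 h
    have hsupp : ∀ ρ : Tour n, ∀ x, ρ.1 x ≠ x := fun ρ x =>
      ρ.2.apply_ne Set.nontrivial_univ (Set.mem_univ x)
    have hcyc : ∀ ρ : Tour n, ρ.1.IsCycle := fun ρ =>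
      Perm.isCycle_iff_exists_isCycleOn.2
        ⟨Set.univ, Set.nontrivial_univ, ρ.2, fun _ _ => Set.mem_univ _⟩
    have hu : ∀ ρ : Tour n, ρ.1.support = Finset.univ := fun ρ => by
      ext x; simpa using hsupp ρ x
    obtain ⟨g, hg⟩ := isConj_iff.1 ((hcyc σ).isConj (hcyc τ) (by rw [hu, hu]))
    exact ⟨g, Subtype.ext hg⟩

/-- A linear functional of the permutation matrix of a tour. -/
def tourSum (c : Mat n) (σ : Tour n) : ℝ := ∑ i, c (i, σ.1 i)

theorem sum_mul_tourMatrix (c : Fin n × Fin n → ℝ) (σ : Tour n) :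
    ∑ a, c a * tourMatrix σ a = ∑ i, c (i, σ.1 i) := by
  rw [Fintype.sum_prod_type]
  refine Finset.sum_congr rfl fun i _ => ?_
  rw [Finset.sum_eq_single (σ.1 i)]
  · simp [tourMatrix, Equiv.Perm.permMatrix, PEquiv.toMatrix_apply]
  · intro j _ hj
    simp [tourMatrix, Equiv.Perm.permMatrix, PEquiv.toMatrix_apply, hj.symm]
  · simp

theorem tourSum_conj (c : Mat n) (g : Perm (Fin n)) (σ : Tour n) :
    tourSum c (Tour.conj g σ) = ∑ k, c (g k, g (σ.1 k)) := by
  unfold tourSum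
  rw [← Equiv.sum_comp g]
  simp [Tour.conj]

/-- Exchanging two nodes changes a linear functional by an amount that depends only on the labels
of those two nodes and of their neighbours. -/
theorem tourSum_conj_sub_swap (c : Mat n) (σ : Tour n) (i j : Fin n) (g : Perm (Fin n))
    (hg : ∀ k ∈ ({i, j, σ.1 i, σ.1 j, σ.1⁻¹ i, σ.1⁻¹ j} : Finset (Fin n)), g k = k) :
    tourSum c (Tour.conj g σ) - tourSum c (Tour.conj g (Tour.conj (swap i j) σ)) =
      tourSum c σ - tourSum c (Tour.conj (swap i j) σ) := by
  have h1 : ∀ h : Perm (Fin n), tourSum c (Tour.conj h σ)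
      - tourSum c (Tour.conj h (Tour.conj (swap i j) σ)) =
      ∑ k, (c (h k, h (σ.1 k)) - c (h (swap i j k), h (swap i j (σ.1 k)))) := fun h => by
    rw [← Tour.conj_mul, tourSum_conj, tourSum_conj, Finset.sum_sub_distrib]
    rfl
  have h2 := h1 1
  rw [Tour.conj_one, Tour.conj_one] at h2
  rw [h1, h2]
  -- The comparison is edge by edge. An edge that avoids $i$ and $j$ contributes zero on both sides;
  -- any other edge, and its image under the swap, has only endpoints fixed by $g$.
  refine Finset.sum_congr rfl fun k _ => ?_
  simp only [Finset.mem_insert, Finset.mem_singleton, forall_eq_or_imp, forall_eq] at hg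
  obtain ⟨g1, g2, g3, g4, g5, g6⟩ := hg
  simp only [Perm.coe_one, id]
  by_cases hki : k = i
  · subst hki; simp only [swap_apply_left, g1, g2, g3]
    by_cases h : σ.1 k = j
    · rw [h, swap_apply_right, g1]
    · by_cases h' : σ.1 k = k
      · rw [h', swap_apply_left, g2]
      · rw [swap_apply_of_ne_of_ne h' h, g3]
  by_cases hkj : k = j
  · subst hkj; simp only [swap_apply_right, g1, g2, g4]
    by_cases h : σ.1 k = i
    · rw [h, swap_apply_left, g2]
    · by_cases h' : σ.1 k = k
      · rw [h', swap_apply_right, g1]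
      · rw [swap_apply_of_ne_of_ne h h', g4]
  rw [swap_apply_of_ne_of_ne hki hkj]
  by_cases hsi : σ.1 k = i
  · have : σ.1⁻¹ i = k := by rw [← hsi]; simp
    rw [this] at g5
    rw [hsi, swap_apply_left, g1, g2, g5]
  by_cases hsj : σ.1 k = j
  · have : σ.1⁻¹ j = k := by rw [← hsj]; simp
    rw [this] at g6
    rw [hsj, swap_apply_right, g1, g2, g6]
  rw [swap_apply_of_ne_of_ne hsi hsj]; ring

/-- The images of the six points sort the permutations into at most $n^6$ classes, and left
translation embeds each nonempty class into the pointwise stabilizer. The points may coincide. -/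
theorem card_perm_le_pow_mul_card_fix (p : Fin 6 → Fin n) :
    Fintype.card (Perm (Fin n)) ≤
      n ^ 6 * (Finset.univ.filter fun g : Perm (Fin n) => ∀ k, g (p k) = p k).card := by
  classical
  have h := Finset.card_le_mul_card_image_of_maps_to
    (f := fun (g : Perm (Fin n)) (k : Fin 6) => g (p k)) (s := Finset.univ)
    (t := Finset.univ) (fun _ _ => Finset.mem_univ _)
    (Finset.univ.filter fun g : Perm (Fin n) => ∀ k, g (p k) = p k).card ?_
  · simpa [mul_comm] using h
  · intro y _
    rcases Finset.eq_empty_or_nonempty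
      (Finset.univ.filter fun g : Perm (Fin n) => (fun k => g (p k)) = y) with he | ⟨g₀, hg₀⟩
    · rw [he]; simp
    · simp only [Finset.mem_filter, Finset.mem_univ, true_and] at hg₀
      refine Finset.card_le_card_of_injOn (fun g => g₀⁻¹ * g) ?_
        (fun _ _ _ _ h => mul_left_cancel h)
      intro g hg
      simp only [Finset.coe_filter, Finset.mem_univ, true_and, Set.mem_ofPred_eq] at hg ⊢
      intro k
      have : g (p k) = g₀ (p k) := by
        rw [← hg₀] at hg; exact congrFun hg k
      simp [this]

theorem sum_conj_eq (F : Tour n → ℝ) (h : Perm (Fin n)) (σ : Tour n) :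
    ∑ g : Perm (Fin n), F (Tour.conj g (Tour.conj h σ)) =
      ∑ g : Perm (Fin n), F (Tour.conj g σ) := by
  rw [← Equiv.sum_comp (Equiv.mulRight h) fun g => F (Tour.conj g σ)]
  refine Finset.sum_congr rfl fun g _ => ?_
  rw [Equiv.coe_mulRight, Tour.conj_mul]

/-- Averaging over all relabellings of one tour is averaging over all tours. -/
theorem card_mul_sum_conj (F : Tour n → ℝ) (σ : Tour n) :
    (Fintype.card (Tour n) : ℝ) * ∑ g : Perm (Fin n), F (Tour.conj g σ) =
      Fintype.card (Perm (Fin n)) * ∑ τ, F τ := by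
  -- Double counting: the inner sum over $g$ is the same for all $\tau$ by transitivity, and for
  -- fixed $g$ the sum over $\tau$ is that of $F$.
  have h1 : ∑ τ : Tour n, ∑ g : Perm (Fin n), F (Tour.conj g τ) =
      Fintype.card (Tour n) * ∑ g : Perm (Fin n), F (Tour.conj g σ) := by
    rw [Finset.sum_congr rfl (g := fun _ => ∑ g : Perm (Fin n), F (Tour.conj g σ))]
    · simp
    · intro τ _
      obtain ⟨h, rfl⟩ := Tour.exists_conj σ τ
      exact sum_conj_eq F h σ
  rw [← h1, Finset.sum_comm]
  rw [Finset.sum_congr rfl (g := fun _ => ∑ τ, F τ)]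
  · simp
  · intro g _
    exact Equiv.sum_comp (Tour.conjEquiv g) F

/-- At least a fraction $n^{-6}$ of the relabellings reproduces the difference exactly, and
$(x-y)^2\le2(x-m)^2+2(y-m)^2$. The centre $m$ is arbitrary because it will be the mean under a Gibbs
measure rather than the uniform mean. -/
theorem sq_tourSum_sub_swap_le (c : Mat n) (m : ℝ) (σ : Tour n) (i j : Fin n) :
    (tourSum c σ - tourSum c (Tour.conj (swap i j) σ)) ^ 2 * Fintype.card (Tour n) ≤
      4 * (n : ℝ) ^ 6 * ∑ τ, (tourSum c τ - m) ^ 2 := by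
  set s := swap i j
  set d := tourSum c σ - tourSum c (Tour.conj s σ) with hd
  set A := ∑ g : Perm (Fin n), (tourSum c (Tour.conj g σ) - m) ^ 2 with hA
  set p : Fin 6 → Fin n := ![i, j, σ.1 i, σ.1 j, σ.1⁻¹ i, σ.1⁻¹ j] with hp
  set S := Finset.univ.filter fun g : Perm (Fin n) => ∀ k, g (p k) = p k with hS
  have h1 : (S.card : ℝ) * d ^ 2 ≤ 4 * A := by
    calc (S.card : ℝ) * d ^ 2 = ∑ g ∈ S, (tourSum c (Tour.conj g σ)
          - tourSum c (Tour.conj g (Tour.conj s σ))) ^ 2 := by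
          rw [Finset.sum_congr rfl (g := fun _ => d ^ 2)]
          · simp
          · intro g hg
            rw [tourSum_conj_sub_swap]
            simp only [hS, Finset.mem_filter, Finset.mem_univ, true_and] at hg
            simp only [Finset.mem_insert, Finset.mem_singleton, forall_eq_or_imp, forall_eq]
            exact ⟨hg 0, hg 1, hg 2, hg 3, hg 4, hg 5⟩
      _ ≤ ∑ g : Perm (Fin n), (tourSum c (Tour.conj g σ)
          - tourSum c (Tour.conj g (Tour.conj s σ))) ^ 2 :=
          Finset.sum_le_sum_of_subset_of_nonneg (Finset.subset_univ _)
            fun _ _ _ => sq_nonneg _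
      _ ≤ ∑ g : Perm (Fin n), (2 * (tourSum c (Tour.conj g σ) - m) ^ 2
          + 2 * (tourSum c (Tour.conj g (Tour.conj s σ)) - m) ^ 2) := by
          refine Finset.sum_le_sum fun g _ => ?_
          nlinarith [sq_nonneg ((tourSum c (Tour.conj g σ) - m)
            + (tourSum c (Tour.conj g (Tour.conj s σ)) - m))]
      _ = 4 * A := by
          rw [Finset.sum_add_distrib, ← Finset.mul_sum, ← Finset.mul_sum,
            sum_conj_eq (fun τ => (tourSum c τ - m) ^ 2) s σ]
          ring
  have h2 : (Fintype.card (Perm (Fin n)) : ℝ) ≤ (n : ℝ) ^ 6 * S.card := by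
    exact_mod_cast card_perm_le_pow_mul_card_fix p
  have h3 := card_mul_sum_conj (fun τ => (tourSum c τ - m) ^ 2) σ
  have hP : (0 : ℝ) < Fintype.card (Perm (Fin n)) := by exact_mod_cast Fintype.card_pos
  refine le_of_mul_le_mul_left ?_ hP
  calc (Fintype.card (Perm (Fin n)) : ℝ) * (d ^ 2 * Fintype.card (Tour n))
      ≤ ((n : ℝ) ^ 6 * S.card) * (d ^ 2 * Fintype.card (Tour n)) := by gcongr
    _ = (n : ℝ) ^ 6 * Fintype.card (Tour n) * (S.card * d ^ 2) := by ring
    _ ≤ (n : ℝ) ^ 6 * Fintype.card (Tour n) * (4 * A) := by gcongr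
    _ = 4 * (n : ℝ) ^ 6 * (Fintype.card (Tour n) * A) := by ring
    _ = _ := by rw [hA, h3]; ring

/-- Multiplying $h$ by the transposition of $x$ and $h(x)$ shrinks the support, so $h$ is a product
of at most $|\mathrm{supp}\,h|$ transpositions, along which the differences telescope. -/
theorem abs_sub_conj_le (f : Tour n → ℝ) {δ : ℝ}
    (hf : ∀ σ i j, |f σ - f (Tour.conj (swap i j) σ)| ≤ δ) (hδ : 0 ≤ δ) (k : ℕ) :
    ∀ (h : Perm (Fin n)), h.support.card ≤ k → ∀ σ, |f σ - f (Tour.conj h σ)| ≤ k * δ := by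
  induction k with
  | zero =>
    intro h hh σ
    have : h = 1 := Perm.support_eq_empty_iff.1 (Finset.card_eq_zero.1 (Nat.le_zero.1 hh))
    simp [this]
  | succ k ih =>
    intro h hh σ
    by_cases h1 : h = 1
    · simp only [h1, Tour.conj_one, sub_self, abs_zero]; positivity
    · obtain ⟨x, hx⟩ : ∃ x, h x ≠ x := by
        by_contra hcon
        push Not at hcon
        exact h1 (Equiv.ext hcon)
      have hlt := Perm.card_support_swap_mul hx
      have hih := ih (swap x (h x) * h) (by omega) σ
      have hsw := hf (Tour.conj (swap x (h x) * h) σ) x (h x)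
      rw [← Tour.conj_mul, ← mul_assoc, swap_mul_self, one_mul] at hsw
      push_cast
      calc |f σ - f (Tour.conj h σ)| ≤ |f σ - f (Tour.conj (swap x (h x) * h) σ)|
            + |f (Tour.conj (swap x (h x) * h) σ) - f (Tour.conj h σ)| := abs_sub_le _ _ _
        _ ≤ k * δ + δ := add_le_add hih hsw
        _ = _ := by ring

/-- Under the uniform distribution on tours, the variance of a linear functional is at least a
polynomial fraction of its squared range. -/
theorem sq_tourSum_sub_le (c : Mat n) (m : ℝ) (σ τ : Tour n) :
    (tourSum c σ - tourSum c τ) ^ 2 * Fintype.card (Tour n) ≤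
      4 * (n : ℝ) ^ 8 * ∑ υ, (tourSum c υ - m) ^ 2 := by
  have hT : (0 : ℝ) < Fintype.card (Tour n) := by exact_mod_cast Fintype.card_pos
  set Q := 4 * (n : ℝ) ^ 6 * (∑ υ, (tourSum c υ - m) ^ 2) / Fintype.card (Tour n) with hQ
  have hQ0 : 0 ≤ Q := by positivity
  obtain ⟨g, rfl⟩ := Tour.exists_conj σ τ
  -- At most $n$ exchanges of size $\sqrt Q$ each: squaring the total raises $n^6$ to $n^8$.
  have h := abs_sub_conj_le (tourSum c) (δ := √Q)
    (fun σ i j => Real.abs_le_sqrt ((le_div_iff₀ hT).2 (sq_tourSum_sub_swap_le c m σ i j)))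
    (Real.sqrt_nonneg _) n g ((Finset.card_le_univ _).trans (by simp)) σ
  have h2 : (tourSum c σ - tourSum c (Tour.conj g σ)) ^ 2 ≤ (n * √Q) ^ 2 := by
    rw [← sq_abs (tourSum c σ - _)]
    gcongr
  rw [mul_pow, Real.sq_sqrt hQ0] at h2
  calc _ ≤ (n : ℝ) ^ 2 * Q * Fintype.card (Tour n) := by gcongr
    _ = _ := by rw [hQ]; field_simp

end TSPGenerator

end

/-! ### Gibbs measures as exponential families. -/

noncomputable section

namespace TSPGenerator

open scoped RealInnerProductSpace

variable {n : ℕ}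

/-- The flattened outer product `E Πᵀ`, so that the score is linear in the parameter. -/
def feature (E : Mat n) (σ : Tour n) : Param n :=
  WithLp.toLp 2 fun p => E p.1 * tourMatrix σ p.2

theorem score_eq_inner (W : Param n) (E : Mat n) (σ : Tour n) :
    score W E σ = ⟪W, feature E σ⟫ := by
  simp only [score, feature, PiLp.inner_apply, Fintype.sum_prod_type]
  simp only [RCLike.inner_apply, conj_trivial]
  exact Finset.sum_congr rfl fun i _ => Finset.sum_congr rfl fun j _ => Finset.sum_congr rfl
    fun k _ => Finset.sum_congr rfl fun l _ => by ring

theorem score_sub (W W' : Param n) (E : Mat n) (σ : Tour n) :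
    score (W - W') E σ = score W E σ - score W' E σ := by
  simp only [score_eq_inner, inner_sub_left]

theorem score_smul (s : ℝ) (W : Param n) (E : Mat n) (σ : Tour n) :
    score (s • W) E σ = s * score W E σ := by
  simp only [score_eq_inner, real_inner_smul_left]

theorem norm_tourMatrix (σ : Tour n) : ‖tourMatrix σ‖ ^ 2 = n := by
  rw [EuclideanSpace.norm_sq_eq]
  have h : ∀ a, ‖tourMatrix σ a‖ ^ 2 = 1 * tourMatrix σ a := fun a => by
    by_cases h : σ.1 a.1 = a.2 <;>
      simp [tourMatrix, Equiv.Perm.permMatrix, PEquiv.toMatrix_apply, h, eq_comm]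
  rw [Finset.sum_congr rfl fun a _ => h a, sum_mul_tourMatrix (fun _ => 1)]
  simp

/-- The norm is exactly $\|E\|\sqrt n$; the bound $n+1$ avoids roots in later estimates. -/
theorem norm_feature (E : Mat n) (σ : Tour n) : ‖feature E σ‖ ≤ ‖E‖ * (n + 1) := by
  have h : ‖feature E σ‖ ^ 2 = ‖E‖ ^ 2 * ‖tourMatrix σ‖ ^ 2 := by
    simp only [EuclideanSpace.norm_sq_eq, feature, Fintype.sum_mul_sum, norm_mul, mul_pow]
    rw [Fintype.sum_prod_type]
  rw [norm_tourMatrix] at h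
  refine le_of_sq_le_sq ?_ (by positivity)
  rw [h, mul_pow]
  gcongr
  nlinarith [(Nat.cast_nonneg n : (0 : ℝ) ≤ n)]

theorem abs_score_le (W : Param n) (E : Mat n) (σ : Tour n) :
    |score W E σ| ≤ ‖W‖ * (‖E‖ * (n + 1)) := by
  rw [score_eq_inner]
  exact (abs_real_inner_le_norm _ _).trans
    (mul_le_mul_of_nonneg_left (norm_feature E σ) (norm_nonneg _))

/-- This makes the variance bound for linear functionals of tours applicable to scores on a fixed
instance. -/
theorem score_eq_tourSum (W : Param n) (E : Mat n) :
    ∃ c : Mat n, ∀ σ, score W E σ = tourSum c σ := by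
  refine ⟨WithLp.toLp 2 fun b => ∑ a, E a * W (a, b), fun σ => ?_⟩
  rw [tourSum, ← sum_mul_tourMatrix, score, Finset.sum_comm]
  simp [Finset.sum_mul]

/-- The partition function of the Gibbs measure. -/
def partition (W : Param n) (E : Mat n) : ℝ := ∑ τ : Tour n, Real.exp (score W E τ)

theorem partition_pos (W : Param n) (E : Mat n) : 0 < partition W E :=
  Finset.sum_pos (fun _ _ => Real.exp_pos _) Finset.univ_nonempty

theorem exp_score_le_partition (W : Param n) (E : Mat n) (σ : Tour n) :
    Real.exp (score W E σ) ≤ partition W E :=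
  Finset.single_le_sum (f := fun τ => Real.exp (score W E τ))
    (fun _ _ => (Real.exp_pos _).le) (Finset.mem_univ σ)

theorem gibbs_eq (W : Param n) (E : Mat n) (σ : Tour n) :
    gibbs W E σ = Real.exp (score W E σ) / partition W E := rfl

theorem gibbs_pos (W : Param n) (E : Mat n) (σ : Tour n) : 0 < gibbs W E σ :=
  div_pos (Real.exp_pos _) (partition_pos W E)

theorem sum_gibbs (W : Param n) (E : Mat n) : ∑ σ, gibbs W E σ = 1 := by
  simp only [gibbs_eq, ← Finset.sum_div]
  exact div_self (partition_pos W E).ne'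

theorem gibbs_le_one (W : Param n) (E : Mat n) (σ : Tour n) : gibbs W E σ ≤ 1 :=
  (div_le_one (partition_pos W E)).2 (exp_score_le_partition W E σ)

theorem log_gibbs (W : Param n) (E : Mat n) (σ : Tour n) :
    Real.log (gibbs W E σ) = score W E σ - Real.log (partition W E) := by
  rw [gibbs_eq, Real.log_div (Real.exp_pos _).ne' (partition_pos W E).ne', Real.log_exp]

theorem log_gibbs_nonpos (W : Param n) (E : Mat n) (σ : Tour n) :
    Real.log (gibbs W E σ) ≤ 0 :=
  Real.log_nonpos (gibbs_pos W E σ).le (gibbs_le_one W E σ)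

/-- If scores are small then the Gibbs probabilities are close to uniform from below. -/
theorem exp_le_gibbs (W : Param n) (E : Mat n) {u : ℝ} (hu : ∀ σ, |score W E σ| ≤ u)
    (σ : Tour n) : Real.exp (-(2 * u)) / Fintype.card (Tour n) ≤ gibbs W E σ := by
  have h1 : partition W E ≤ Fintype.card (Tour n) * Real.exp u := by
    calc partition W E ≤ ∑ _τ : Tour n, Real.exp u :=
          Finset.sum_le_sum fun τ _ => Real.exp_le_exp.2 (le_of_abs_le (hu τ))
      _ = _ := by simp
  have h2 : Real.exp (-u) ≤ Real.exp (score W E σ) :=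
    Real.exp_le_exp.2 (neg_le_of_abs_le (hu σ))
  have hT : (0 : ℝ) < Fintype.card (Tour n) := by exact_mod_cast Fintype.card_pos
  rw [gibbs_eq, div_le_div_iff₀ hT (partition_pos W E)]
  calc Real.exp (-(2 * u)) * partition W E
      ≤ Real.exp (-(2 * u)) * (Fintype.card (Tour n) * Real.exp u) := by gcongr
    _ = Real.exp (-u) * Fintype.card (Tour n) := by
        rw [show -(2 * u) = -u + -u by ring, Real.exp_add]
        have : Real.exp (-u) * Real.exp u = 1 := by rw [← Real.exp_add]; simp
        linear_combination (Real.exp (-u) * Fintype.card (Tour n)) * this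
    _ ≤ _ := by gcongr

theorem neg_log_gibbs_le (W : Param n) (E : Mat n) {u : ℝ} (hu : ∀ σ, |score W E σ| ≤ u)
    (σ : Tour n) :
    -Real.log (gibbs W E σ) ≤ Real.log (Fintype.card (Tour n)) + 2 * u := by
  have hT : (0 : ℝ) < Fintype.card (Tour n) := by exact_mod_cast Fintype.card_pos
  have h := Real.log_le_log (by positivity) (exp_le_gibbs W E hu σ)
  rw [Real.log_div (Real.exp_pos _).ne' hT.ne', Real.log_exp] at h
  linarith

/-- Relative entropy to the uniform distribution is nonnegative: apply $\log x\le x-1$ at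
$x=1/(p_\sigma\cdot\#\mathrm{tours})$ and average. -/
theorem neg_log_card_le_entropy (W : Param n) (E : Mat n) :
    -Real.log (Fintype.card (Tour n)) ≤ ∑ σ, gibbs W E σ * Real.log (gibbs W E σ) := by
  have hT : (0 : ℝ) < Fintype.card (Tour n) := by exact_mod_cast Fintype.card_pos
  have h : ∀ σ, gibbs W E σ - 1 / Fintype.card (Tour n) ≤
      gibbs W E σ * Real.log (gibbs W E σ)
        + gibbs W E σ * Real.log (Fintype.card (Tour n)) := fun σ => by
    have hp := gibbs_pos W E σ
    have h1 := Real.log_le_sub_one_of_pos (x := 1 / (gibbs W E σ * Fintype.card (Tour n)))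
      (by positivity)
    rw [Real.log_div one_ne_zero (by positivity), Real.log_one,
      Real.log_mul hp.ne' hT.ne'] at h1
    have h2 := mul_le_mul_of_nonneg_left h1 hp.le
    have h3 : gibbs W E σ * (1 / (gibbs W E σ * Fintype.card (Tour n)) - 1) =
        1 / Fintype.card (Tour n) - gibbs W E σ := by field_simp
    rw [h3] at h2
    linarith
  have hs := Finset.sum_le_sum fun σ (_ : σ ∈ Finset.univ) => h σ
  rw [Finset.sum_sub_distrib, Finset.sum_add_distrib, ← Finset.sum_mul, sum_gibbs] at hs
  simp only [Finset.sum_const, Finset.card_univ, nsmul_eq_mul] at hs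
  rw [mul_one_div_cancel hT.ne'] at hs
  linarith

theorem entropy_nonpos (W : Param n) (E : Mat n) :
    ∑ σ, gibbs W E σ * Real.log (gibbs W E σ) ≤ 0 :=
  Finset.sum_nonpos fun σ _ =>
    mul_nonpos_of_nonneg_of_nonpos (gibbs_pos W E σ).le (log_gibbs_nonpos W E σ)

/-- The mean feature under the Gibbs measure. -/
def meanFeature (W : Param n) (E : Mat n) : Param n := ∑ σ, gibbs W E σ • feature E σ

theorem inner_meanFeature (V W : Param n) (E : Mat n) :
    ⟪V, meanFeature W E⟫ = ∑ σ, gibbs W E σ * score V E σ := by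
  simp only [meanFeature, inner_sum, real_inner_smul_right, score_eq_inner]

theorem norm_meanFeature (W : Param n) (E : Mat n) : ‖meanFeature W E‖ ≤ ‖E‖ * (n + 1) := by
  calc ‖meanFeature W E‖ ≤ ∑ σ, ‖gibbs W E σ • feature E σ‖ := norm_sum_le _ _
    _ ≤ ∑ σ, gibbs W E σ * (‖E‖ * (n + 1)) := by
        refine Finset.sum_le_sum fun σ _ => ?_
        rw [norm_smul, Real.norm_of_nonneg (gibbs_pos W E σ).le]
        exact mul_le_mul_of_nonneg_left (norm_feature E σ) (gibbs_pos W E σ).le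
    _ = _ := by rw [← Finset.sum_mul, sum_gibbs, one_mul]

/-- As in any exponential family, the log-partition function has the mean feature as gradient; the
factor $s$ is the chain rule. -/
theorem hasGradientAt_log_gibbs (s : ℝ) (W : Param n) (E : Mat n) (σ : Tour n) :
    HasGradientAt (fun W' : Param n => Real.log (gibbs (s • W') E σ))
      (s • (feature E σ - meanFeature (s • W) E)) W := by
  rw [hasGradientAt_iff_hasFDerivAt]
  have hsc : ∀ τ, HasFDerivAt (fun W' : Param n => score (s • W') E τ)
      (s • innerSL ℝ (feature E τ)) W := fun τ => by
    have h : (fun W' : Param n => score (s • W') E τ) =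
        fun W' => (s • innerSL ℝ (feature E τ)) W' := by
      funext W'
      simp [score_eq_inner, real_inner_smul_left, real_inner_comm W']
    rw [h]
    exact ContinuousLinearMap.hasFDerivAt _
  have hZ : HasFDerivAt (fun W' : Param n => partition (s • W') E)
      (∑ τ, Real.exp (score (s • W) E τ) • s • innerSL ℝ (feature E τ)) W := by
    unfold partition
    exact HasFDerivAt.fun_sum fun τ _ => (hsc τ).exp
  have h := (hsc σ).fun_sub (hZ.log (partition_pos (s • W) E).ne')
  simp only [log_gibbs]
  refine h.congr_fderiv ?_
  ext V
  simp only [sub_apply, smul_apply,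
    sum_apply, InnerProductSpace.toDual_apply_apply, innerSL_apply_apply,
    smul_eq_mul, real_inner_smul_left, inner_sub_left]
  rw [real_inner_comm V (meanFeature _ _), inner_meanFeature, mul_sub, Finset.mul_sum,
    Finset.mul_sum]
  congr 1
  refine Finset.sum_congr rfl fun τ _ => ?_
  rw [gibbs_eq, score_eq_inner V, real_inner_comm V]
  ring

theorem policySample_eq (M : Mat n) (lam s : ℝ) (W : Param n) (E : Mat n) (σ : Tour n) :
    policySample M lam s W E σ =
      (cost M E σ + lam / s * Real.log (gibbs (s • W) E σ)) •
        s • (feature E σ - meanFeature (s • W) E) := by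
  rw [policySample, (hasGradientAt_log_gibbs s W E σ).gradient]

/-- The regularized expected cost of the component of scale `s` on one instance. -/
def scaleObj (M : Mat n) (lam s : ℝ) (W : Param n) (E : Mat n) : ℝ :=
  ∑ σ, gibbs (s • W) E σ * (cost M E σ + lam / s * Real.log (gibbs (s • W) E σ))

/-- The expected policy gradient sample of the component of scale `s` on one instance. -/
def scaleGrad (M : Mat n) (lam s : ℝ) (W : Param n) (E : Mat n) : Param n :=
  ∑ σ, gibbs (s • W) E σ • policySample M lam s W E σ

/-- The likelihood ratio identity $\nabla\phi=\phi\,\nabla\log\phi$ produces the policy gradient.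
The extra term, from differentiating the logarithm inside the entropy, vanishes because
$\nabla\log\phi$ has mean zero. -/
theorem hasGradientAt_scaleObj (M : Mat n) (lam s : ℝ) (W : Param n) (E : Mat n) :
    HasGradientAt (fun W' => scaleObj M lam s W' E) (scaleGrad M lam s W E) W := by
  rw [hasGradientAt_iff_hasFDerivAt]
  have hl : ∀ σ, HasFDerivAt (fun W' : Param n => Real.log (gibbs (s • W') E σ))
      (innerSL ℝ (s • (feature E σ - meanFeature (s • W) E))) W := fun σ =>
    (hasGradientAt_log_gibbs s W E σ).hasFDerivAt
  have hg : ∀ σ, HasFDerivAt (fun W' : Param n => gibbs (s • W') E σ)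
      (gibbs (s • W) E σ • innerSL ℝ (s • (feature E σ - meanFeature (s • W) E))) W :=
    fun σ => by
      have h := (hl σ).exp
      simp only [Real.exp_log (gibbs_pos _ _ _)] at h
      exact h
  have h := HasFDerivAt.fun_sum (u := Finset.univ) fun σ _ =>
    (hg σ).fun_mul (((hl σ).const_mul (lam / s)).const_add (cost M E σ))
  refine h.congr_fderiv ?_
  ext V
  have h0 : ∑ σ, gibbs (s • W) E σ * ⟪feature E σ - meanFeature (s • W) E, V⟫ = 0 := by
    simp only [inner_sub_left, mul_sub, Finset.sum_sub_distrib, ← Finset.sum_mul, sum_gibbs]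
    rw [real_inner_comm V (meanFeature _ _), inner_meanFeature, one_mul, sub_eq_zero]
    exact Finset.sum_congr rfl fun τ _ => by rw [score_eq_inner, real_inner_comm]
  simp only [scaleGrad, policySample_eq, add_apply,
    smul_apply, sum_apply, sum_inner,
    InnerProductSpace.toDual_apply_apply, innerSL_apply_apply, smul_eq_mul,
    real_inner_smul_left]
  rw [Finset.sum_add_distrib]
  have h1 : ∑ σ, gibbs (s • W) E σ * (lam / s *
      (s * ⟪feature E σ - meanFeature (s • W) E, V⟫)) = 0 := by
    rw [← mul_zero (lam / s * s), ← h0, Finset.mul_sum]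
    exact Finset.sum_congr rfl fun τ _ => by ring
  rw [h1, zero_add]
  exact Finset.sum_congr rfl fun τ _ => by ring

/-! ### Comparison with the optimal parameter on one instance. -/

section Comparison

variable {M : Mat n} {lam : ℝ} {Wbar : Param n}

/-- In $\frac{\lambda}{s}\log\phi(sW)$ the factor $s$ of the score cancels, so its linear part joins
the cost to form a score of $W-\overline W$. -/
theorem scaleObj_eq (hM : ∀ E σ, cost M E σ = -(lam * score Wbar E σ)) {s : ℝ} (hs : s ≠ 0)
    (W : Param n) (E : Mat n) :
    scaleObj M lam s W E = lam * ∑ σ, gibbs (s • W) E σ * score (W - Wbar) E σ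
      - lam / s * Real.log (partition (s • W) E) := by
  have h : ∀ σ, gibbs (s • W) E σ * (cost M E σ + lam / s * Real.log (gibbs (s • W) E σ)) =
      lam * (gibbs (s • W) E σ * score (W - Wbar) E σ)
        - gibbs (s • W) E σ * (lam / s * Real.log (partition (s • W) E)) := fun σ => by
    rw [hM, log_gibbs, score_sub, score_smul]; field_simp; ring
  rw [scaleObj, Finset.sum_congr rfl fun σ _ => h σ, Finset.sum_sub_distrib, ← Finset.mul_sum,
    ← Finset.sum_mul, sum_gibbs, one_mul]

theorem scaleObj_opt (hM : ∀ E σ, cost M E σ = -(lam * score Wbar E σ)) {s : ℝ} (hs : s ≠ 0)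
    (E : Mat n) :
    scaleObj M lam s Wbar E = -(lam / s * Real.log (partition (s • Wbar) E)) := by
  rw [scaleObj_eq hM hs]
  simp [score_eq_inner]

/-- Suboptimality is a scaled cumulant generating function (a Kullback–Leibler divergence). -/
theorem scaleObj_sub_opt (hM : ∀ E σ, cost M E σ = -(lam * score Wbar E σ)) {s : ℝ}
    (hs : s ≠ 0) (W : Param n) (E : Mat n) :
    scaleObj M lam s W E - scaleObj M lam s Wbar E =
      lam / s * Real.log (∑ σ, gibbs (s • W) E σ * Real.exp (s *
        ((∑ τ, gibbs (s • W) E τ * score (W - Wbar) E τ) - score (W - Wbar) E σ))) := by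
  set m := ∑ τ, gibbs (s • W) E τ * score (W - Wbar) E τ with hm
  -- Exponential tilting: weighting $\phi(sW)$ by $\exp(-s\,\mathrm{score}(W-\overline W))$ replaces
  -- the numerator by that of $\phi(s\overline W)$, which leaves a ratio of partition functions.
  have h : ∑ σ, gibbs (s • W) E σ * Real.exp (s * (m - score (W - Wbar) E σ)) =
      Real.exp (s * m) * (partition (s • Wbar) E / partition (s • W) E) := by
    rw [partition.eq_def (s • Wbar), Finset.sum_div, Finset.mul_sum]
    refine Finset.sum_congr rfl fun σ _ => ?_
    rw [gibbs_eq, mul_div_assoc', div_mul_eq_mul_div, ← Real.exp_add, ← Real.exp_add, score_sub,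
      score_smul, score_smul]
    ring_nf
  rw [h, Real.log_mul (Real.exp_pos _).ne'
    (div_pos (partition_pos _ _) (partition_pos _ _)).ne', Real.log_exp,
    Real.log_div (partition_pos _ _).ne' (partition_pos _ _).ne', scaleObj_opt hM hs,
    scaleObj_eq hM hs, ← hm]
  field_simp
  ring

/-- Jensen's inequality for the exponential moment of a centred variable, in the form $e^x\ge1+x$.
-/
theorem scaleObj_opt_le (hlam : 0 < lam) (hM : ∀ E σ, cost M E σ = -(lam * score Wbar E σ))
    {s : ℝ} (hs : 0 < s) (W : Param n) (E : Mat n) :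
    scaleObj M lam s Wbar E ≤ scaleObj M lam s W E := by
  rw [← sub_nonneg, scaleObj_sub_opt hM hs.ne']
  refine mul_nonneg (by positivity) (Real.log_nonneg ?_)
  set m := ∑ τ, gibbs (s • W) E τ * score (W - Wbar) E τ with hm
  calc (1 : ℝ) = ∑ σ, gibbs (s • W) E σ * (s * (m - score (W - Wbar) E σ) + 1) := by
        have h : ∀ σ, gibbs (s • W) E σ * (s * (m - score (W - Wbar) E σ) + 1) =
            gibbs (s • W) E σ * (s * m + 1)
              - s * (gibbs (s • W) E σ * score (W - Wbar) E σ) := fun σ => by ring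
        rw [Finset.sum_congr rfl fun σ _ => h σ, Finset.sum_sub_distrib, ← Finset.mul_sum,
          ← Finset.sum_mul, sum_gibbs, ← hm]
        ring
    _ ≤ _ := Finset.sum_le_sum fun σ _ =>
        mul_le_mul_of_nonneg_left (Real.add_one_le_exp _) (gibbs_pos _ _ _).le

/-- The logarithmic moment of a centred finitely supported variable is at most its squared
range. -/
theorem log_sum_exp_centred_le {ι : Type*} [Fintype ι] {p x : ι → ℝ} (hp : ∀ i, 0 ≤ p i)
    (hp1 : ∑ i, p i = 1) (hx : ∑ i, p i * x i = 0) {Δ : ℝ} (hΔ : ∀ i, |x i| ≤ Δ) :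
    Real.log (∑ i, p i * Real.exp (x i)) ≤ Δ ^ 2 := by
  have hpos : 0 < ∑ i, p i * Real.exp (x i) := by
    obtain ⟨i, -, hi⟩ := Finset.exists_ne_zero_of_sum_ne_zero (hp1.trans_ne one_ne_zero)
    exact Finset.sum_pos' (fun i _ => mul_nonneg (hp i) (Real.exp_pos _).le)
      ⟨i, Finset.mem_univ i, mul_pos (lt_of_le_of_ne (hp i) hi.symm) (Real.exp_pos _)⟩
  -- For $\Delta\le1$ use $e^x\le1+x+x^2$, whose linear term averages to zero; for $\Delta>1$ the
  -- trivial bound $\Delta$ is below $\Delta^2$.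
  rcases le_or_gt Δ 1 with h1 | h1
  · refine (Real.log_le_sub_one_of_pos hpos).trans ?_
    have h : ∀ i, p i * Real.exp (x i) ≤ p i + p i * x i + p i * Δ ^ 2 := fun i => by
      have h2 := Real.abs_exp_sub_one_sub_id_le ((hΔ i).trans h1)
      have h3 : x i ^ 2 ≤ Δ ^ 2 := sq_le_sq' (neg_le_of_abs_le (hΔ i)) (le_of_abs_le (hΔ i))
      have h4 := mul_le_mul_of_nonneg_left (le_of_abs_le h2) (hp i)
      have h5 := mul_le_mul_of_nonneg_left h3 (hp i)
      linarith
    have hs := Finset.sum_le_sum fun i (_ : i ∈ Finset.univ) => h i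
    rw [Finset.sum_add_distrib, Finset.sum_add_distrib, ← Finset.sum_mul, hp1, hx] at hs
    linarith
  · have h2 : Real.log (∑ i, p i * Real.exp (x i)) ≤ Δ := by
      rw [Real.log_le_iff_le_exp hpos]
      calc _ ≤ ∑ i, p i * Real.exp Δ := Finset.sum_le_sum fun i _ =>
            mul_le_mul_of_nonneg_left (Real.exp_le_exp.2 (le_of_abs_le (hΔ i))) (hp i)
        _ = _ := by rw [← Finset.sum_mul, hp1, one_mul]
    nlinarith

/-- The mean lies within $\Delta$ of every score, so the exponent in the moment is centred and
bounded by $s\Delta$, and $\frac{\lambda}{s}(s\Delta)^2=\lambda s\Delta^2$. -/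
theorem scaleObj_sub_opt_le (hlam : 0 < lam)
    (hM : ∀ E σ, cost M E σ = -(lam * score Wbar E σ)) {s : ℝ} (hs : 0 < s) (W : Param n)
    (E : Mat n) {Δ : ℝ} (hΔ : ∀ σ τ, |score (W - Wbar) E τ - score (W - Wbar) E σ| ≤ Δ) :
    scaleObj M lam s W E - scaleObj M lam s Wbar E ≤ lam * s * Δ ^ 2 := by
  rw [scaleObj_sub_opt hM hs.ne']
  set m := ∑ τ, gibbs (s • W) E τ * score (W - Wbar) E τ with hm
  have hdev : ∀ σ, |s * (m - score (W - Wbar) E σ)| ≤ s * Δ := fun σ => by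
    rw [abs_mul, abs_of_pos hs]
    gcongr
    have : m - score (W - Wbar) E σ =
        ∑ τ, gibbs (s • W) E τ * (score (W - Wbar) E τ - score (W - Wbar) E σ) := by
      simp only [mul_sub, Finset.sum_sub_distrib, ← Finset.sum_mul, sum_gibbs, one_mul, hm]
    rw [this]
    calc _ ≤ ∑ τ, |gibbs (s • W) E τ * (score (W - Wbar) E τ - score (W - Wbar) E σ)| :=
          Finset.abs_sum_le_sum_abs _ _
      _ ≤ ∑ τ, gibbs (s • W) E τ * Δ := Finset.sum_le_sum fun τ _ => by
          rw [abs_mul, abs_of_pos (gibbs_pos _ _ _)]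
          exact mul_le_mul_of_nonneg_left (hΔ σ τ) (gibbs_pos _ _ _).le
      _ = Δ := by rw [← Finset.sum_mul, sum_gibbs, one_mul]
  have h0 : ∑ σ, gibbs (s • W) E σ * (s * (m - score (W - Wbar) E σ)) = 0 := by
    have h : ∀ σ, gibbs (s • W) E σ * (s * (m - score (W - Wbar) E σ)) =
        gibbs (s • W) E σ * (s * m)
          - s * (gibbs (s • W) E σ * score (W - Wbar) E σ) := fun σ => by ring
    rw [Finset.sum_congr rfl fun σ _ => h σ, Finset.sum_sub_distrib, ← Finset.mul_sum,
      ← Finset.sum_mul, sum_gibbs, ← hm]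
    ring
  have h := log_sum_exp_centred_le (fun σ => (gibbs_pos (s • W) E σ).le) (sum_gibbs _ _) h0 hdev
  calc _ ≤ lam / s * (s * Δ) ^ 2 := by gcongr
    _ = _ := by field_simp

/-- Along the direction from the optimum, the gradient is a variance of the score. -/
theorem inner_scaleGrad (hM : ∀ E σ, cost M E σ = -(lam * score Wbar E σ)) {s : ℝ}
    (hs : s ≠ 0) (W : Param n) (E : Mat n) :
    ⟪scaleGrad M lam s W E, W - Wbar⟫ =
      lam * s * ∑ σ, gibbs (s • W) E σ * (score (W - Wbar) E σ
        - ∑ τ, gibbs (s • W) E τ * score (W - Wbar) E τ) ^ 2 := by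
  set m := ∑ τ, gibbs (s • W) E τ * score (W - Wbar) E τ with hm
  have hin : ∀ σ, ⟪feature E σ - meanFeature (s • W) E, W - Wbar⟫ =
      score (W - Wbar) E σ - m := fun σ => by
    rw [inner_sub_left, real_inner_comm, ← score_eq_inner, real_inner_comm (W - Wbar),
      inner_meanFeature]
  simp only [scaleGrad, policySample_eq, sum_inner, real_inner_smul_left, hin]
  -- With $D$ the score of $W-\overline W$, the weight is $\lambda D$ minus a constant. Centring $D$
  -- leaves the variance term and a constant multiple of $D-m$, which averages to zero.
  have h : ∀ σ, gibbs (s • W) E σ * ((cost M E σ + lam / s * Real.log (gibbs (s • W) E σ)) *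
      (s * (score (W - Wbar) E σ - m))) =
      lam * s * (gibbs (s • W) E σ * (score (W - Wbar) E σ - m) ^ 2)
      + (lam * s * m - lam * Real.log (partition (s • W) E)) *
        (gibbs (s • W) E σ * score (W - Wbar) E σ - gibbs (s • W) E σ * m) := fun σ => by
    rw [hM, log_gibbs, score_smul, score_sub]; field_simp; ring
  rw [Finset.sum_congr rfl fun σ _ => h σ, Finset.sum_add_distrib, ← Finset.mul_sum,
    ← Finset.mul_sum, Finset.sum_sub_distrib, ← Finset.sum_mul, sum_gibbs, ← hm]
  ring

theorem inner_scaleGrad_nonneg (hlam : 0 < lam)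
    (hM : ∀ E σ, cost M E σ = -(lam * score Wbar E σ)) {s : ℝ}
    (hs : 0 < s) (W : Param n) (E : Mat n) : 0 ≤ ⟪scaleGrad M lam s W E, W - Wbar⟫ := by
  rw [inner_scaleGrad hM hs.ne']
  exact mul_nonneg (by positivity)
    (Finset.sum_nonneg fun σ _ => mul_nonneg (gibbs_pos _ _ _).le (sq_nonneg _))

/-- In the nearly uniform component the gradient controls the squared range of the scores. -/
theorem sq_range_le_inner_scaleGrad (hlam : 0 < lam)
    (hM : ∀ E σ, cost M E σ = -(lam * score Wbar E σ)) {s : ℝ} (hs : 0 < s) (W : Param n)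
    (E : Mat n) (hsmall : ∀ σ, |score (s • W) E σ| ≤ 1 / 4) (σ τ : Tour n) :
    lam * s * (score (W - Wbar) E τ - score (W - Wbar) E σ) ^ 2 ≤
      8 * ((n : ℝ) + 1) ^ 8 * ⟪scaleGrad M lam s W E, W - Wbar⟫ := by
  have hT : (0 : ℝ) < Fintype.card (Tour n) := by exact_mod_cast Fintype.card_pos
  obtain ⟨c, hc⟩ := score_eq_tourSum (W - Wbar) E
  rw [inner_scaleGrad hM hs.ne']
  simp only [hc]
  set m := ∑ τ, gibbs (s • W) E τ * tourSum c τ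
  have h1 := sq_tourSum_sub_le c m τ σ
  -- The threshold $1/4$ gives $e^{-1/2}\ge1/2$: each probability is at least half the uniform one,
  -- which turns the constant $4$ of the uniform bound into $8$.
  have h2 : ∀ υ, 1 ≤ 2 * Fintype.card (Tour n) * gibbs (s • W) E υ := fun υ => by
    have h3 := exp_le_gibbs (s • W) E hsmall υ
    have h4 : (1 : ℝ) / 2 ≤ Real.exp (-(2 * (1 / 4))) := by
      have := Real.add_one_le_exp (-(2 * (1 / 4) : ℝ)); linarith
    rw [div_le_iff₀ hT] at h3
    linarith
  have h3 : ∑ υ, (tourSum c υ - m) ^ 2 ≤ 2 * Fintype.card (Tour n) *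
      ∑ υ, gibbs (s • W) E υ * (tourSum c υ - m) ^ 2 := by
    rw [Finset.mul_sum]
    refine Finset.sum_le_sum fun υ _ => ?_
    have := mul_le_mul_of_nonneg_right (h2 υ) (sq_nonneg (tourSum c υ - m))
    linarith
  have h4 : (tourSum c τ - tourSum c σ) ^ 2 ≤
      8 * (n : ℝ) ^ 8 * ∑ υ, gibbs (s • W) E υ * (tourSum c υ - m) ^ 2 := by
    refine le_of_mul_le_mul_right ?_ hT
    refine h1.trans ((mul_le_mul_of_nonneg_left h3 (by positivity)).trans_eq ?_)
    ring
  have h5 : 0 ≤ ∑ υ, gibbs (s • W) E υ * (tourSum c υ - m) ^ 2 :=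
    Finset.sum_nonneg fun υ _ => mul_nonneg (gibbs_pos _ _ _).le (sq_nonneg _)
  calc _ ≤ lam * s * (8 * (n : ℝ) ^ 8 *
        ∑ υ, gibbs (s • W) E υ * (tourSum c υ - m) ^ 2) := by gcongr
    _ ≤ lam * s * (8 * ((n : ℝ) + 1) ^ 8 *
        ∑ υ, gibbs (s • W) E υ * (tourSum c υ - m) ^ 2) := by gcongr; linarith
    _ = _ := by ring

/-- The regularized value at $\overline W$ is a negative scaled log-partition function, and one term
of the partition sum already brings it below the cost of $\sigma$. Removing the entropy costs at
most its range. -/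
theorem sum_gibbs_cost_le (hlam : 0 < lam)
    (hM : ∀ E σ, cost M E σ = -(lam * score Wbar E σ)) {s : ℝ} (hs : 0 < s) (E : Mat n)
    (σ : Tour n) :
    ∑ τ, gibbs (s • Wbar) E τ * cost M E τ ≤
      cost M E σ + lam / s * Real.log (Fintype.card (Tour n)) := by
  have h1 : scaleObj M lam s Wbar E ≤ cost M E σ := by
    rw [scaleObj_opt hM hs.ne', hM, neg_le_neg_iff]
    have h := (Real.le_log_iff_exp_le (partition_pos _ _)).2
      (exp_score_le_partition (s • Wbar) E σ)
    rw [score_smul] at h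
    calc lam * score Wbar E σ = lam / s * (s * score Wbar E σ) := by field_simp
      _ ≤ _ := by gcongr
  have h2 : scaleObj M lam s Wbar E = ∑ τ, gibbs (s • Wbar) E τ * cost M E τ
      + lam / s * ∑ τ, gibbs (s • Wbar) E τ * Real.log (gibbs (s • Wbar) E τ) := by
    rw [scaleObj, Finset.mul_sum, ← Finset.sum_add_distrib]
    exact Finset.sum_congr rfl fun τ _ => by ring
  have h3 := mul_le_mul_of_nonneg_left (neg_log_card_le_entropy (s • Wbar) E)
    (show 0 ≤ lam / s by positivity)
  linarith

end Comparison

end TSPGenerator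

end

noncomputable section

namespace TSPGenerator

open scoped RealInnerProductSpace

variable {n : ℕ}

/-! ### Joint continuity in the parameter and the instance -/

theorem continuous_score (s : ℝ) (σ : Tour n) :
    Continuous fun p : Param n × Mat n => score (s • p.1) p.2 σ := by
  unfold score
  simp only [PiLp.smul_apply]
  fun_prop

theorem continuous_gibbs (s : ℝ) (σ : Tour n) :
    Continuous fun p : Param n × Mat n => gibbs (s • p.1) p.2 σ := by
  unfold gibbs
  have h := fun τ => (continuous_score (n := n) s τ).rexp
  exact (h σ).div (continuous_finsetSum _ fun τ _ => h τ) fun p =>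
    (partition_pos (s • p.1) p.2).ne'

theorem continuous_gibbs_right (W : Param n) (σ : Tour n) :
    Continuous fun E : Mat n => gibbs W E σ := by
  have h := (continuous_gibbs (1 : ℝ) σ).comp (Continuous.prodMk_right W)
  simpa only [Function.comp_def, one_smul] using h

theorem continuous_log_gibbs_right (W : Param n) (σ : Tour n) :
    Continuous fun E : Mat n => Real.log (gibbs W E σ) :=
  (continuous_gibbs_right W σ).log fun _ => (gibbs_pos _ _ _).ne'

theorem continuous_entropy (W : Param n) :
    Continuous fun E : Mat n => ∑ σ, gibbs W E σ * Real.log (gibbs W E σ) :=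
  continuous_finsetSum _ fun σ _ =>
    (continuous_gibbs_right W σ).mul (continuous_log_gibbs_right W σ)

theorem continuous_log_gibbs (s : ℝ) (σ : Tour n) :
    Continuous fun p : Param n × Mat n => Real.log (gibbs (s • p.1) p.2 σ) :=
  (continuous_gibbs s σ).log fun _ => (gibbs_pos _ _ _).ne'

theorem continuous_cost (M : Mat n) (σ : Tour n) : Continuous fun E : Mat n => cost M E σ := by
  unfold cost
  fun_prop

theorem continuous_feature (σ : Tour n) : Continuous fun E : Mat n => feature E σ := by
  unfold feature
  fun_prop

theorem continuous_meanFeature (s : ℝ) :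
    Continuous fun p : Param n × Mat n => meanFeature (s • p.1) p.2 := by
  unfold meanFeature
  exact continuous_finsetSum _ fun τ _ =>
    (continuous_gibbs s τ).smul ((continuous_feature τ).comp continuous_snd)

theorem continuous_policySample (M : Mat n) (lam s : ℝ) (σ : Tour n) :
    Continuous fun p : Param n × Mat n => policySample M lam s p.1 p.2 σ := by
  simp only [policySample_eq]
  exact (((continuous_cost M σ).comp continuous_snd).add
    ((continuous_log_gibbs s σ).const_mul _)).smul
    ((((continuous_feature σ).comp continuous_snd).sub (continuous_meanFeature s)).const_smul s)

theorem continuous_scaleObj (M : Mat n) (lam s : ℝ) :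
    Continuous fun p : Param n × Mat n => scaleObj M lam s p.1 p.2 := by
  unfold scaleObj
  exact continuous_finsetSum _ fun σ _ => (continuous_gibbs s σ).mul
    (((continuous_cost M σ).comp continuous_snd).add ((continuous_log_gibbs s σ).const_mul _))

theorem continuous_scaleGrad (M : Mat n) (lam s : ℝ) :
    Continuous fun p : Param n × Mat n => scaleGrad M lam s p.1 p.2 := by
  unfold scaleGrad
  exact continuous_finsetSum _ fun σ _ =>
    (continuous_gibbs s σ).smul (continuous_policySample M lam s σ)

/-! ### The regularized loss of one instance -/

/-- The regularized loss on one instance. -/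
def instObj (M : Mat n) (β ρ lam : ℝ) (W : Param n) (E : Mat n) : ℝ :=
  (1 - β) * scaleObj M lam 1 W E + β * scaleObj M lam ρ W E

/-- The gradient of the regularized loss on one instance. -/
def instGrad (M : Mat n) (β ρ lam : ℝ) (W : Param n) (E : Mat n) : Param n :=
  (1 - β) • scaleGrad M lam 1 W E + β • scaleGrad M lam ρ W E

theorem continuous_instObj (M : Mat n) (β ρ lam : ℝ) :
    Continuous fun p : Param n × Mat n => instObj M β ρ lam p.1 p.2 :=
  ((continuous_scaleObj M lam 1).const_mul _).add ((continuous_scaleObj M lam ρ).const_mul _)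

theorem continuous_instGrad (M : Mat n) (β ρ lam : ℝ) :
    Continuous fun p : Param n × Mat n => instGrad M β ρ lam p.1 p.2 :=
  ((continuous_scaleGrad M lam 1).const_smul (1 - β)).add
    ((continuous_scaleGrad M lam ρ).const_smul β)

theorem hasGradientAt_instObj (M : Mat n) (β ρ lam : ℝ) (W : Param n) (E : Mat n) :
    HasGradientAt (fun W' => instObj M β ρ lam W' E) (instGrad M β ρ lam W E) W := by
  have h1 := (hasGradientAt_scaleObj M lam 1 W E).hasFDerivAt.const_mul (1 - β)
  have h2 := (hasGradientAt_scaleObj M lam ρ W E).hasFDerivAt.const_mul β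
  rw [hasGradientAt_iff_hasFDerivAt]
  refine (h1.add h2).congr_fderiv ?_
  simp [instGrad]

theorem negEntropy_nonpos (μ : Measure (Mat n)) (W : Param n) : negEntropy μ W ≤ 0 :=
  integral_nonpos fun E => entropy_nonpos W E

/-- A continuous function is bounded on the compact ball that carries the measure. This serves both
the prior on instances and the laws of the SGD iterates. -/
theorem integrable_of_ae_norm_le {X Y : Type*} [NormedAddCommGroup X]
    [SecondCountableTopology X] [NormedAddCommGroup Y] [ProperSpace Y] [MeasurableSpace Y]
    [OpensMeasurableSpace Y] {μ : Measure Y} [IsFiniteMeasure μ] {D : ℝ}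
    (hμ : ∀ᵐ y ∂μ, ‖y‖ ≤ D) {f : Y → X} (hf : Continuous f) : Integrable f μ := by
  obtain ⟨C, hC⟩ := (isCompact_closedBall (0 : Y) D).exists_bound_of_continuousOn
    hf.continuousOn
  refine Integrable.of_bound hf.aestronglyMeasurable C ?_
  filter_upwards [hμ] with y hy
  exact hC y (by simpa using hy)

/-! ### Differentiation under the expectation over instances. -/

section Expectation

variable {D : ℝ} {μ : Measure (Mat n)} [IsProbabilityMeasure μ]

/-- Dominated differentiation: by joint continuity the gradient is bounded on the compact product of
the unit ball around $W$ and the ball of instances. -/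
theorem hasGradientAt_integral {H : Type*} [NormedAddCommGroup H] [InnerProductSpace ℝ H]
    [ProperSpace H] [CompleteSpace H] [SecondCountableTopology H] [MeasurableSpace H]
    [BorelSpace H] (hμ : ∀ᵐ E ∂μ, ‖E‖ ≤ D) {G : H → Mat n → ℝ} {g : H → Mat n → H}
    (hG : ∀ W, Continuous (G W)) (hg : Continuous fun p : H × Mat n => g p.1 p.2)
    (hd : ∀ W E, HasGradientAt (fun W' => G W' E) (g W E) W) (W : H) :
    HasGradientAt (fun W' => ∫ E, G W' E ∂μ) (∫ E, g W E ∂μ) W := by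
  obtain ⟨C, hC⟩ := ((isCompact_closedBall W 1).prod
    (isCompact_closedBall (0 : Mat n) D)).exists_bound_of_continuousOn hg.continuousOn
  have hg' : ∀ W, Continuous (g W) := fun W => hg.comp (Continuous.prodMk_right W)
  have hbound : ∀ᵐ E ∂μ, ∀ W' ∈ Metric.closedBall W 1,
      ‖InnerProductSpace.toDual ℝ H (g W' E)‖ ≤ C := by
    filter_upwards [hμ] with E hE W' hW'
    rw [LinearIsometryEquiv.norm_map]
    exact hC (W', E) ⟨hW', mem_closedBall_zero_iff.2 hE⟩
  have hmeas : AEStronglyMeasurable (fun E => InnerProductSpace.toDual ℝ H (g W E)) μ :=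
    ((InnerProductSpace.toDual ℝ H).continuous.comp (hg' W)).aestronglyMeasurable
  have hint : Integrable (fun E => InnerProductSpace.toDual ℝ H (g W E)) μ :=
    Integrable.of_bound hmeas C
      (hbound.mono fun E hE => hE W (Metric.mem_closedBall_self zero_le_one))
  rw [hasGradientAt_iff_hasFDerivAt]
  have h := hasFDerivAt_integral_of_dominated_of_fderiv_le (𝕜 := ℝ) (μ := μ)
    (F := G) (F' := fun W E => InnerProductSpace.toDual ℝ H (g W E)) (x₀ := W)
    (bound := fun _ => C) (Metric.closedBall_mem_nhds W one_pos)
    (Filter.Eventually.of_forall fun W => (hG W).aestronglyMeasurable)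
    (integrable_of_ae_norm_le hμ (hG W)) hmeas hbound (integrable_const C)
    (Filter.Eventually.of_forall fun E W' _ => (hd W' E).hasFDerivAt)
  refine h.congr_fderiv ?_
  ext V
  rw [ContinuousLinearMap.integral_apply hint]
  simp only [InnerProductSpace.toDual_apply_apply]
  simp only [real_inner_comm V]
  exact integral_inner (integrable_of_ae_norm_le hμ (hg' W)) V

/-- The weight $\beta/\rho$ of the slow entropy gives that component the temperature $\lambda/\rho$,
as required for both components to share the minimizer $\overline W$. -/
theorem regLoss_eq_integral (hμ : ∀ᵐ E ∂μ, ‖E‖ ≤ D) (M : Mat n) (β ρ lam : ℝ) (W : Param n) :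
    regLoss μ M β ρ lam W = ∫ E, instObj M β ρ lam W E ∂μ := by
  have hL : Continuous fun E : Mat n => ∑ σ, generator β ρ W E σ * cost M E σ := by
    unfold generator
    exact continuous_finsetSum _ fun σ _ =>
      ((continuous_const.mul (continuous_gibbs_right W σ)).add
        (continuous_const.mul (continuous_gibbs_right (ρ • W) σ))).mul (continuous_cost M σ)
  have h1 := continuous_entropy W
  have hH := continuous_entropy (ρ • W)
  unfold regLoss loss regularizer negEntropy
  rw [← integral_const_mul, ← integral_const_mul, ← integral_add, ← integral_const_mul,
    ← integral_add]
  · refine integral_congr_ae (Filter.Eventually.of_forall fun E => ?_)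
    simp only [instObj, scaleObj, generator, one_smul, Finset.mul_sum, ← Finset.sum_add_distrib]
    exact Finset.sum_congr rfl fun σ _ => by ring
  · exact integrable_of_ae_norm_le hμ hL
  · exact integrable_of_ae_norm_le hμ
      (((h1.const_mul _).add (hH.const_mul _)).const_mul lam)
  · exact integrable_of_ae_norm_le hμ (h1.const_mul _)
  · exact integrable_of_ae_norm_le hμ (hH.const_mul _)

theorem hasGradientAt_regLoss (hμ : ∀ᵐ E ∂μ, ‖E‖ ≤ D) (M : Mat n) (β ρ lam : ℝ)
    (W : Param n) :
    HasGradientAt (regLoss μ M β ρ lam) (∫ E, instGrad M β ρ lam W E ∂μ) W := by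
  rw [funext (regLoss_eq_integral hμ M β ρ lam)]
  exact hasGradientAt_integral hμ
    (fun W => Continuous.uncurry_left (f := instObj M β ρ lam) W
      (continuous_instObj M β ρ lam)) (continuous_instGrad M β ρ lam)
    (hasGradientAt_instObj M β ρ lam) W

theorem continuous_regLoss (hμ : ∀ᵐ E ∂μ, ‖E‖ ≤ D) (M : Mat n) (β ρ lam : ℝ) :
    Continuous (regLoss μ M β ρ lam) :=
  continuous_iff_continuousAt.2 fun W =>
    (hasGradientAt_regLoss hμ M β ρ lam W).hasFDerivAt.continuousAt

theorem continuous_loss (hμ : ∀ᵐ E ∂μ, ‖E‖ ≤ D) (M : Mat n) (β ρ : ℝ) :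
    Continuous (loss μ M β ρ) := by
  have h := continuous_regLoss hμ M β ρ 0
  unfold regLoss at h
  simpa using h

theorem neg_log_card_le_negEntropy (W : Param n) :
    -Real.log (Fintype.card (Tour n)) ≤ negEntropy μ W := by
  have hT : (1 : ℝ) ≤ Fintype.card (Tour n) := by
    exact_mod_cast Nat.succ_le_of_lt Fintype.card_pos
  have hint : Integrable (fun E : Mat n => ∑ σ, gibbs W E σ * Real.log (gibbs W E σ)) μ := by
    refine Integrable.of_bound (continuous_entropy W).aestronglyMeasurable (Real.log (Fintype.card (Tour n)))
      (Filter.Eventually.of_forall fun E => ?_)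
    rw [Real.norm_eq_abs, abs_le]
    exact ⟨neg_log_card_le_entropy W E, (entropy_nonpos W E).trans (Real.log_nonneg hT)⟩
  calc _ = ∫ _E, -Real.log (Fintype.card (Tour n)) ∂μ := by simp
    _ ≤ _ := integral_mono (integrable_const _) hint fun E => neg_log_card_le_entropy W E

end Expectation

end TSPGenerator

end

noncomputable section

namespace TSPGenerator

open scoped RealInnerProductSpace

variable {n : ℕ}

/-! ### The policy gradient oracle -/

theorem continuous_instObj_right (M : Mat n) (β ρ lam : ℝ) (W : Param n) :
    Continuous (instObj M β ρ lam W) :=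
  Continuous.uncurry_left (f := instObj M β ρ lam) W (continuous_instObj M β ρ lam)

theorem continuous_instGrad_right (M : Mat n) (β ρ lam : ℝ) (W : Param n) :
    Continuous (instGrad M β ρ lam W) :=
  Continuous.uncurry_left (f := instGrad M β ρ lam) W (continuous_instGrad M β ρ lam)

/-- The law of the policy gradient sample on a fixed instance. -/
def instLaw (M : Mat n) (β ρ lam : ℝ) (W : Param n) (E : Mat n) : Measure (Param n) :=
  ∑ σ : Tour n,
    (ENNReal.ofReal ((1 - β) * gibbs W E σ) • Measure.dirac (policySample M lam 1 W E σ) +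
      ENNReal.ofReal (β * gibbs (ρ • W) E σ) • Measure.dirac (policySample M lam ρ W E σ))

theorem measurable_instLaw (M : Mat n) (β ρ lam : ℝ) :
    Measurable fun p : Param n × Mat n => instLaw M β ρ lam p.1 p.2 := by
  refine Measure.measurable_of_measurable_coe _ fun s hs => ?_
  have hd : ∀ t : ℝ, ∀ σ, Measurable fun p : Param n × Mat n =>
      Measure.dirac (policySample M lam t p.1 p.2 σ) s := fun t σ =>
    (Measure.measurable_coe hs).comp
      (Measure.measurable_dirac.comp (continuous_policySample M lam t σ).measurable)
  have hg : ∀ t : ℝ, ∀ σ, Measurable fun p : Param n × Mat n => gibbs (t • p.1) p.2 σ :=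
    fun t σ => (continuous_gibbs t σ).measurable
  have hg1 := hg 1
  simp only [one_smul] at hg1
  simp only [instLaw, Measure.coe_finsetSum, Finset.sum_apply, Measure.coe_add, Pi.add_apply,
    Measure.smul_apply, smul_eq_mul]
  exact Finset.measurable_sum _ fun σ _ =>
    (((hg1 σ).const_mul (1 - β)).ennreal_ofReal.mul (hd 1 σ)).add
      (((hg ρ σ).const_mul β).ennreal_ofReal.mul (hd ρ σ))

/-- The law of the policy gradient sample, as a kernel from instances. -/
def instKernel (M : Mat n) (β ρ lam : ℝ) (W : Param n) : Kernel (Mat n) (Param n) where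
  toFun := instLaw M β ρ lam W
  measurable' := Measurable.of_uncurry_left (f := instLaw M β ρ lam)
    (measurable_instLaw M β ρ lam)

/-- The policy gradient estimate, as a kernel from parameters. -/
def policyKernel (μ : Measure (Mat n)) [SFinite μ] (M : Mat n) (β ρ lam : ℝ) :
    Kernel (Param n) (Param n) where
  toFun := policyGradientLaw μ M β ρ lam
  measurable' := by
    refine Measure.measurable_of_measurable_coe _ fun s hs => ?_
    have h : ∀ W, policyGradientLaw μ M β ρ lam W s = ∫⁻ E, instLaw M β ρ lam W E s ∂μ :=
      fun W => Measure.bind_apply hs (instKernel M β ρ lam W).measurable.aemeasurable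
    simp only [h]
    exact Measurable.lintegral_prod_right'
      ((Measure.measurable_coe hs).comp (measurable_instLaw M β ρ lam))

theorem policyKernel_apply (μ : Measure (Mat n)) [SFinite μ] (M : Mat n) (β ρ lam : ℝ)
    (W : Param n) :
    policyKernel μ M β ρ lam W = μ.bind (instKernel M β ρ lam W) := rfl

section Oracle

variable {β ρ lam : ℝ}

theorem instLaw_univ (hβ0 : 0 ≤ β) (hβ1 : β ≤ 1) (M : Mat n) (W : Param n) (E : Mat n) :
    instLaw M β ρ lam W E Set.univ = 1 := by
  simp only [instLaw, Measure.coe_finsetSum, Finset.sum_apply, Measure.coe_add, Pi.add_apply,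
    Measure.smul_apply, smul_eq_mul, measure_univ, mul_one]
  have h : ∀ σ, ENNReal.ofReal ((1 - β) * gibbs W E σ) + ENNReal.ofReal (β * gibbs (ρ • W) E σ) =
      ENNReal.ofReal ((1 - β) * gibbs W E σ + β * gibbs (ρ • W) E σ) := fun σ =>
    (ENNReal.ofReal_add (mul_nonneg (by linarith) (gibbs_pos _ _ _).le)
      (mul_nonneg hβ0 (gibbs_pos _ _ _).le)).symm
  rw [Finset.sum_congr rfl fun σ _ => h σ, ← ENNReal.ofReal_sum_of_nonneg, Finset.sum_add_distrib,
    ← Finset.mul_sum, ← Finset.mul_sum, sum_gibbs, sum_gibbs]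
  · simp
  · exact fun σ _ => add_nonneg (mul_nonneg (by linarith) (gibbs_pos _ _ _).le)
      (mul_nonneg hβ0 (gibbs_pos _ _ _).le)

theorem isMarkovKernel_instKernel (hβ0 : 0 ≤ β) (hβ1 : β ≤ 1) (M : Mat n) (W : Param n) :
    IsMarkovKernel (instKernel M β ρ lam W) :=
  ⟨fun E => ⟨instLaw_univ hβ0 hβ1 M W E⟩⟩

theorem isMarkovKernel_policyKernel (μ : Measure (Mat n)) [IsProbabilityMeasure μ]
    (hβ0 : 0 ≤ β) (hβ1 : β ≤ 1) (M : Mat n) : IsMarkovKernel (policyKernel μ M β ρ lam) :=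
  ⟨fun W => by
    have := isMarkovKernel_instKernel (ρ := ρ) (lam := lam) hβ0 hβ1 M W
    rw [policyKernel_apply]
    infer_instance⟩

theorem integral_instLaw (hβ0 : 0 ≤ β) (hβ1 : β ≤ 1) (M : Mat n) (W : Param n) (E : Mat n) :
    ∫ g, g ∂(instLaw M β ρ lam W E) = instGrad M β ρ lam W E := by
  have hint : ∀ (a : ℝ) (x : Param n),
      Integrable (fun g : Param n => g) (ENNReal.ofReal a • Measure.dirac x) := fun a x =>
    (integrable_dirac (by simp)).smul_measure ENNReal.ofReal_ne_top
  rw [instLaw, integral_finsetSum_measure fun σ _ => (hint _ _).add_measure (hint _ _)]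
  have h : ∀ σ, ∫ g, g ∂(ENNReal.ofReal ((1 - β) * gibbs W E σ) •
      Measure.dirac (policySample M lam 1 W E σ) + ENNReal.ofReal (β * gibbs (ρ • W) E σ) •
        Measure.dirac (policySample M lam ρ W E σ)) =
      (1 - β) • gibbs W E σ • policySample M lam 1 W E σ
        + β • gibbs (ρ • W) E σ • policySample M lam ρ W E σ := fun σ => by
    rw [integral_add_measure (hint _ _) (hint _ _), integral_smul_measure, integral_smul_measure,
      integral_dirac, integral_dirac,
      ENNReal.toReal_ofReal (mul_nonneg (by linarith) (gibbs_pos _ _ _).le),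
      ENNReal.toReal_ofReal (mul_nonneg hβ0 (gibbs_pos _ _ _).le), mul_smul, mul_smul]
  rw [Finset.sum_congr rfl fun σ _ => h σ, Finset.sum_add_distrib, ← Finset.smul_sum,
    ← Finset.smul_sum, instGrad, scaleGrad, scaleGrad, one_smul]

variable {M : Mat n} {Wbar : Param n} {B D : ℝ}

/-- The bound on the norm of policy gradient samples. -/
def sampleBound (n : ℕ) (lam B D : ℝ) : ℝ :=
  lam * (Real.log (Fintype.card (Tour n)) + 3 * (B * (D * (n + 1)))) * (2 * (D * (n + 1)))

/-- The factor $1/s$ of the log-probability is cancelled by the $s$ from the chain rule, so the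
bound does not degrade as $s\to0$. -/
theorem norm_policySample_le (hlam : 0 < lam)
    (hM : ∀ E σ, cost M E σ = -(lam * score Wbar E σ)) (hWbar : ‖Wbar‖ ≤ B) {s : ℝ}
    (hs : 0 < s) (hs1 : s ≤ 1) {W : Param n} (hW : ‖W‖ ≤ B) {E : Mat n} (hE : ‖E‖ ≤ D)
    (σ : Tour n) : ‖policySample M lam s W E σ‖ ≤ sampleBound n lam B D := by
  have hB : 0 ≤ B := (norm_nonneg _).trans hW
  have hD : 0 ≤ D := (norm_nonneg _).trans hE
  have hT : (1 : ℝ) ≤ Fintype.card (Tour n) := by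
    exact_mod_cast Nat.succ_le_of_lt Fintype.card_pos
  set Y := D * ((n : ℝ) + 1) with hY
  set ℓ := Real.log (Fintype.card (Tour n)) with hℓ
  have hℓ0 : 0 ≤ ℓ := Real.log_nonneg hT
  have hY0 : 0 ≤ Y := by positivity
  have hEY : ‖E‖ * ((n : ℝ) + 1) ≤ Y := by rw [hY]; gcongr
  have hsc : ∀ V : Param n, ‖V‖ ≤ B → ∀ τ, |score V E τ| ≤ B * Y := fun V hV τ =>
    (abs_score_le V E τ).trans (by gcongr)
  have h1 : |cost M E σ| ≤ lam * (B * Y) := by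
    rw [hM, abs_neg, abs_mul, abs_of_pos hlam]
    exact mul_le_mul_of_nonneg_left (hsc _ hWbar σ) hlam.le
  have h2 : |Real.log (gibbs (s • W) E σ)| ≤ ℓ + 2 * (s * (B * Y)) := by
    rw [abs_of_nonpos (log_gibbs_nonpos _ _ _)]
    refine neg_log_gibbs_le _ _ (fun τ => ?_) σ
    rw [score_smul, abs_mul, abs_of_pos hs]
    exact mul_le_mul_of_nonneg_left (hsc W hW τ) hs.le
  have h3 : ‖feature E σ - meanFeature (s • W) E‖ ≤ 2 * Y :=
    (norm_sub_le _ _).trans (by linarith [norm_feature E σ, norm_meanFeature (s • W) E])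
  have h4 : |cost M E σ + lam / s * Real.log (gibbs (s • W) E σ)| * s ≤
      lam * (ℓ + 3 * (B * Y)) := by
    have h5 : |cost M E σ + lam / s * Real.log (gibbs (s • W) E σ)| ≤
        lam * (B * Y) + lam / s * (ℓ + 2 * (s * (B * Y))) := by
      refine (abs_add_le _ _).trans (add_le_add h1 ?_)
      rw [abs_mul, abs_of_pos (div_pos hlam hs)]
      gcongr
    calc _ ≤ (lam * (B * Y) + lam / s * (ℓ + 2 * (s * (B * Y)))) * s := by gcongr
      _ = s * (lam * (B * Y)) + lam * ℓ + 2 * (s * (lam * (B * Y))) := by field_simp; ring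
      _ ≤ 1 * (lam * (B * Y)) + lam * ℓ + 2 * (1 * (lam * (B * Y))) := by gcongr
      _ = _ := by ring
  rw [policySample_eq, norm_smul, norm_smul, Real.norm_eq_abs, Real.norm_of_nonneg hs.le,
    ← mul_assoc]
  exact mul_le_mul h4 h3 (norm_nonneg _) (by positivity)

variable {μ : Measure (Mat n)} [IsProbabilityMeasure μ]

theorem ae_norm_le_policyKernel (hμ : ∀ᵐ E ∂μ, ‖E‖ ≤ D) (hlam : 0 < lam) (hρ0 : 0 < ρ)
    (hρ1 : ρ ≤ 1) (hM : ∀ E σ, cost M E σ = -(lam * score Wbar E σ)) (hWbar : ‖Wbar‖ ≤ B)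
    {W : Param n} (hW : ‖W‖ ≤ B) :
    ∀ᵐ g ∂(policyKernel μ M β ρ lam W), ‖g‖ ≤ sampleBound n lam B D := by
  have hs : MeasurableSet {g : Param n | ¬‖g‖ ≤ sampleBound n lam B D} :=
    (measurableSet_le measurable_norm measurable_const).compl
  rw [ae_iff, policyKernel_apply, Measure.bind_apply hs (Kernel.aemeasurable _)]
  refine (lintegral_congr_ae ?_).trans lintegral_zero
  filter_upwards [hμ] with E hE
  change instLaw M β ρ lam W E _ = 0
  simp only [instLaw, Measure.coe_finsetSum, Finset.sum_apply, Measure.coe_add, Pi.add_apply,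
    Measure.smul_apply, smul_eq_mul]
  refine Finset.sum_eq_zero fun σ _ => ?_
  have h : ∀ s : ℝ, 0 < s → s ≤ 1 → Measure.dirac (policySample M lam s W E σ)
      {g : Param n | ¬‖g‖ ≤ sampleBound n lam B D} = 0 := fun s hs0 hs1 => by
    rw [Measure.dirac_apply' _ hs]
    simpa using norm_policySample_le hlam hM hWbar hs0 hs1 hW hE σ
  rw [h 1 one_pos le_rfl, h ρ hρ0 hρ1]
  simp

theorem integral_policyKernel (hμ : ∀ᵐ E ∂μ, ‖E‖ ≤ D) (hlam : 0 < lam) (hρ0 : 0 < ρ)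
    (hρ1 : ρ ≤ 1) (hβ0 : 0 ≤ β) (hβ1 : β ≤ 1)
    (hM : ∀ E σ, cost M E σ = -(lam * score Wbar E σ)) (hWbar : ‖Wbar‖ ≤ B)
    {W : Param n} (hW : ‖W‖ ≤ B) :
    ∫ g, g ∂(policyKernel μ M β ρ lam W) = ∫ E, instGrad M β ρ lam W E ∂μ := by
  have := isMarkovKernel_policyKernel (ρ := ρ) (lam := lam) μ hβ0 hβ1 M
  have := isMarkovKernel_instKernel (ρ := ρ) (lam := lam) hβ0 hβ1 M W
  have hint : Integrable (fun g : Param n => g) (policyKernel μ M β ρ lam W) :=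
    Integrable.of_bound aestronglyMeasurable_id _
      (ae_norm_le_policyKernel hμ hlam hρ0 hρ1 hM hWbar hW)
  rw [policyKernel_apply, Measure.comp_eq_comp_const_apply] at hint ⊢
  rw [ProbabilityTheory.Kernel.integral_comp hint, Kernel.const_apply]
  exact integral_congr_ae (Filter.Eventually.of_forall fun E => integral_instLaw hβ0 hβ1 M W E)

theorem isGradientOracle_policyKernel (hμ : ∀ᵐ E ∂μ, ‖E‖ ≤ D) (hlam : 0 < lam) (hρ0 : 0 < ρ)
    (hρ1 : ρ ≤ 1) (hβ0 : 0 ≤ β) (hβ1 : β ≤ 1)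
    (hM : ∀ E σ, cost M E σ = -(lam * score Wbar E σ)) (hWbar : ‖Wbar‖ ≤ B) :
    IsGradientOracle (policyKernel μ M β ρ lam) (regLoss μ M β ρ lam) B
      (4 * sampleBound n lam B D ^ 2) := by
  intro W hW
  rw [mem_closedBall_zero_iff] at hW
  have := isMarkovKernel_policyKernel (ρ := ρ) (lam := lam) μ hβ0 hβ1 M
  have hb := ae_norm_le_policyKernel (β := β) hμ hlam hρ0 hρ1 hM hWbar hW
  refine ⟨MemLp.of_bound aestronglyMeasurable_id _ hb, ?_, ?_⟩
  · rw [integral_policyKernel hμ hlam hρ0 hρ1 hβ0 hβ1 hM hWbar hW]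
    exact hasGradientAt_regLoss hμ M β ρ lam W
  · have hm : ‖∫ g, g ∂(policyKernel μ M β ρ lam W)‖ ≤ sampleBound n lam B D := by
      simpa using norm_integral_le_of_norm_le_const hb
    calc _ ≤ ∫ _g, 4 * sampleBound n lam B D ^ 2 ∂(policyKernel μ M β ρ lam W) := by
          refine integral_mono_of_nonneg (Filter.Eventually.of_forall fun g => by positivity)
            (integrable_const _) ?_
          filter_upwards [hb] with g hg
          have h := (norm_sub_le g (∫ g', g' ∂(policyKernel μ M β ρ lam W))).trans
            (add_le_add hg hm)
          calc _ ≤ (sampleBound n lam B D + sampleBound n lam B D) ^ 2 := by gcongr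
            _ = _ := by ring
      _ = _ := by simp

/-- The gradient of the regularized loss is bounded by the bound on the samples. -/
theorem norm_gradient_le (hμ : ∀ᵐ E ∂μ, ‖E‖ ≤ D) (hlam : 0 < lam) (hρ0 : 0 < ρ)
    (hρ1 : ρ ≤ 1) (hβ0 : 0 ≤ β) (hβ1 : β ≤ 1)
    (hM : ∀ E σ, cost M E σ = -(lam * score Wbar E σ)) (hWbar : ‖Wbar‖ ≤ B)
    {W : Param n} (hW : ‖W‖ ≤ B) :
    ‖∫ E, instGrad M β ρ lam W E ∂μ‖ ≤ sampleBound n lam B D := by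
  have := isMarkovKernel_policyKernel (ρ := ρ) (lam := lam) μ hβ0 hβ1 M
  rw [← integral_policyKernel hμ hlam hρ0 hρ1 hβ0 hβ1 hM hWbar hW]
  simpa using norm_integral_le_of_norm_le_const
    (ae_norm_le_policyKernel (β := β) hμ hlam hρ0 hρ1 hM hWbar hW)

/-! ### Quasar convexity -/

/-- Both components are suboptimal by at most $\lambda\Delta^2$, with $\Delta$ the attained range.
The slow gradient pays for this; of the fast gradient only the sign of its pairing with $W-\overline
W$ is used. -/
theorem instObj_sub_le (hlam : 0 < lam) (hρ0 : 0 < ρ) (hρ1 : ρ ≤ 1) (hβ0 : 0 < β)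
    (hβ1 : β ≤ 1) (hM : ∀ E σ, cost M E σ = -(lam * score Wbar E σ)) {W : Param n} {E : Mat n}
    (hsmall : ∀ σ, |score (ρ • W) E σ| ≤ 1 / 4) :
    β * ρ * (instObj M β ρ lam W E - instObj M β ρ lam Wbar E) ≤
      8 * ((n : ℝ) + 1) ^ 8 * ⟪instGrad M β ρ lam W E, W - Wbar⟫ := by
  obtain ⟨⟨σ, τ⟩, hmax⟩ := Finite.exists_max fun p : Tour n × Tour n =>
    |score (W - Wbar) E p.2 - score (W - Wbar) E p.1|
  set Δ := |score (W - Wbar) E τ - score (W - Wbar) E σ| with hΔ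
  have hΔ' : ∀ σ τ, |score (W - Wbar) E τ - score (W - Wbar) E σ| ≤ Δ :=
    fun σ τ => hmax (σ, τ)
  have h1 := scaleObj_sub_opt_le hlam hM one_pos W E hΔ'
  have h2 := scaleObj_sub_opt_le hlam hM hρ0 W E hΔ'
  have h3 := sq_range_le_inner_scaleGrad hlam hM hρ0 W E hsmall σ τ
  rw [← sq_abs, ← hΔ] at h3
  have h4 := inner_scaleGrad_nonneg hlam hM one_pos W E
  have h5 : instObj M β ρ lam W E - instObj M β ρ lam Wbar E ≤ lam * Δ ^ 2 := by
    have h6 : lam * ρ * Δ ^ 2 ≤ lam * Δ ^ 2 := by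
      have : 0 ≤ lam * Δ ^ 2 := by positivity
      nlinarith
    have h7 := mul_le_mul_of_nonneg_left h1 (sub_nonneg.2 hβ1)
    have h8 := mul_le_mul_of_nonneg_left (h2.trans h6) hβ0.le
    unfold instObj
    linarith
  rw [instGrad, inner_add_left, real_inner_smul_left, real_inner_smul_left]
  have h9 : 0 ≤ 8 * ((n : ℝ) + 1) ^ 8 * ((1 - β) * ⟪scaleGrad M lam 1 W E, W - Wbar⟫) :=
    mul_nonneg (by positivity) (mul_nonneg (sub_nonneg.2 hβ1) h4)
  calc _ ≤ β * ρ * (lam * Δ ^ 2) := by gcongr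
    _ = β * (lam * ρ * Δ ^ 2) := by ring
    _ ≤ β * (8 * ((n : ℝ) + 1) ^ 8 * ⟪scaleGrad M lam ρ W E, W - Wbar⟫) := by gcongr
    _ ≤ _ := by linarith

theorem regLoss_sub_le (hμ : ∀ᵐ E ∂μ, ‖E‖ ≤ D) (hlam : 0 < lam) (hρ0 : 0 < ρ) (hρ1 : ρ ≤ 1)
    (hβ0 : 0 < β) (hβ1 : β ≤ 1) (hM : ∀ E σ, cost M E σ = -(lam * score Wbar E σ))
    (hsmall : ρ * (B * (D * (n + 1))) ≤ 1 / 4) {W : Param n} (hW : ‖W‖ ≤ B) :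
    β * ρ * (regLoss μ M β ρ lam W - regLoss μ M β ρ lam Wbar) ≤
      8 * ((n : ℝ) + 1) ^ 8 * ⟪∫ E, instGrad M β ρ lam W E ∂μ, W - Wbar⟫ := by
  have hB : 0 ≤ B := (norm_nonneg _).trans hW
  have hG : ∀ W, Integrable (instObj M β ρ lam W) μ := fun W => integrable_of_ae_norm_le hμ
    (continuous_instObj_right M β ρ lam W)
  have hg : Integrable (instGrad M β ρ lam W) μ := integrable_of_ae_norm_le hμ
    (continuous_instGrad_right M β ρ lam W)
  rw [regLoss_eq_integral hμ, regLoss_eq_integral hμ, ← integral_sub (hG _) (hG _),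
    real_inner_comm, ← integral_inner hg, ← integral_const_mul, ← integral_const_mul]
  refine integral_mono_ae (((hG _).sub (hG _)).const_mul _) ((hg.const_inner _).const_mul _) ?_
  filter_upwards [hμ] with E hE
  rw [real_inner_comm]
  refine instObj_sub_le hlam hρ0 hρ1 hβ0 hβ1 hM fun σ => ?_
  have hD : 0 ≤ D := (norm_nonneg _).trans hE
  rw [score_smul, abs_mul, abs_of_pos hρ0]
  refine le_trans ?_ hsmall
  refine mul_le_mul_of_nonneg_left ((abs_score_le W E σ).trans ?_) hρ0.le
  gcongr

theorem regLoss_opt_le (hμ : ∀ᵐ E ∂μ, ‖E‖ ≤ D) (hlam : 0 < lam) (hρ0 : 0 < ρ)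
    (hβ0 : 0 ≤ β) (hβ1 : β ≤ 1) (hM : ∀ E σ, cost M E σ = -(lam * score Wbar E σ))
    (W : Param n) : regLoss μ M β ρ lam Wbar ≤ regLoss μ M β ρ lam W := by
  have hG : ∀ W, Integrable (instObj M β ρ lam W) μ := fun W => integrable_of_ae_norm_le hμ
    (continuous_instObj_right M β ρ lam W)
  rw [regLoss_eq_integral hμ, regLoss_eq_integral hμ]
  refine integral_mono (hG _) (hG _) fun E => ?_
  exact add_le_add
    (mul_le_mul_of_nonneg_left (scaleObj_opt_le hlam hM one_pos W E) (sub_nonneg.2 hβ1))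
    (mul_le_mul_of_nonneg_left (scaleObj_opt_le hlam hM hρ0 W E) hβ0)

/-- The entropy prices $\lambda$ and $\lambda/\rho$ of the components are averaged with weights
$1-\beta$ and $\beta$. -/
theorem loss_opt_le (hμ : ∀ᵐ E ∂μ, ‖E‖ ≤ D) (hlam : 0 < lam) (hρ0 : 0 < ρ)
    (hβ0 : 0 ≤ β) (hβ1 : β ≤ 1) (hM : ∀ E σ, cost M E σ = -(lam * score Wbar E σ)) :
    loss μ M β ρ Wbar ≤
      opt μ M + lam * (1 - β + β / ρ) * Real.log (Fintype.card (Tour n)) := by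
  have hmin : Continuous fun E : Mat n => ⨅ σ : Tour n, cost M E σ := by
    simp only [← Finset.inf'_univ_eq_ciInf]
    exact Continuous.finset_inf'_apply _ fun σ _ => continuous_cost M σ
  have hL : Continuous fun E : Mat n => ∑ σ, generator β ρ Wbar E σ * cost M E σ :=
    continuous_finsetSum _ fun σ _ =>
      ((continuous_const.mul (continuous_gibbs_right Wbar σ)).add
        (continuous_const.mul (continuous_gibbs_right (ρ • Wbar) σ))).mul (continuous_cost M σ)
  have hi := integrable_of_ae_norm_le hμ hmin
  have h : loss μ M β ρ Wbar ≤ ∫ E, ((⨅ σ : Tour n, cost M E σ)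
      + lam * (1 - β + β / ρ) * Real.log (Fintype.card (Tour n))) ∂μ := by
    refine integral_mono (integrable_of_ae_norm_le hμ hL) (hi.add (integrable_const _))
      fun E => ?_
    obtain ⟨σ, hσ⟩ := exists_eq_ciInf_of_finite (f := fun σ : Tour n => cost M E σ)
    have h1 := sum_gibbs_cost_le hlam hM one_pos E σ
    have h2 := sum_gibbs_cost_le hlam hM hρ0 E σ
    rw [one_smul, div_one] at h1
    have h3 := mul_le_mul_of_nonneg_left h1 (sub_nonneg.2 hβ1)
    have h4 := mul_le_mul_of_nonneg_left h2 hβ0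
    have h5 : ∑ σ, generator β ρ Wbar E σ * cost M E σ =
        (1 - β) * ∑ τ, gibbs Wbar E τ * cost M E τ
          + β * ∑ τ, gibbs (ρ • Wbar) E τ * cost M E τ := by
      rw [Finset.mul_sum, Finset.mul_sum, ← Finset.sum_add_distrib]
      exact Finset.sum_congr rfl fun τ _ => by unfold generator; ring
    simp only at hσ ⊢
    rw [h5, ← hσ]
    calc _ ≤ _ := add_le_add h3 h4
      _ = _ := by ring
  refine h.trans_eq ?_
  rw [integral_add hi (integrable_const _)]
  simp [opt]

/-- Closeness in regularized loss implies closeness in loss, up to the range of the entropy. -/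
theorem loss_sub_le (hlam : 0 < lam) (hρ0 : 0 < ρ) (hβ0 : 0 ≤ β) (hβ1 : β ≤ 1) (M : Mat n)
    (W W' : Param n) :
    loss μ M β ρ W - loss μ M β ρ W' ≤ regLoss μ M β ρ lam W - regLoss μ M β ρ lam W'
      + lam * (1 - β + β / ρ) * Real.log (Fintype.card (Tour n)) := by
  have h1 : regularizer μ β ρ W' ≤ 0 :=
    add_nonpos (mul_nonpos_of_nonneg_of_nonpos (sub_nonneg.2 hβ1) (negEntropy_nonpos _ _))
      (mul_nonpos_of_nonneg_of_nonpos (by positivity) (negEntropy_nonpos _ _))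
  have h2 : -((1 - β + β / ρ) * Real.log (Fintype.card (Tour n))) ≤ regularizer μ β ρ W := by
    have h3 := mul_le_mul_of_nonneg_left (neg_log_card_le_negEntropy (μ := μ) W)
      (sub_nonneg.2 hβ1)
    have h4 := mul_le_mul_of_nonneg_left (neg_log_card_le_negEntropy (μ := μ) (ρ • W))
      (show 0 ≤ β / ρ by positivity)
    unfold regularizer
    linarith
  have h5 := mul_le_mul_of_nonneg_left h1 hlam.le
  have h6 := mul_le_mul_of_nonneg_left h2 hlam.le
  unfold regLoss
  linarith

end Oracle

end TSPGenerator

end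

noncomputable section

namespace TSPGenerator

open scoped RealInnerProductSpace

variable {n : ℕ}

/-! ### Projected stochastic gradient descent -/

theorem norm_projBall_le {B : ℝ} (hB : 0 ≤ B) (W : Param n) : ‖projBall B W‖ ≤ B := by
  unfold projBall
  split_ifs with h
  · exact h
  · have hW : 0 < ‖W‖ := hB.trans_lt (not_le.1 h)
    rw [norm_smul, Real.norm_of_nonneg (by positivity), div_mul_cancel₀ _ hW.ne']

/-- When $W$ is outside the ball and $t$ scales it back, $W-W'=(tW-W')+(1-t)W$, and the two summands
have nonnegative inner product. -/
theorem norm_projBall_sub_le {B : ℝ} {W' : Param n} (hW' : ‖W'‖ ≤ B) (W : Param n) :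
    ‖projBall B W - W'‖ ≤ ‖W - W'‖ := by
  have hB : 0 ≤ B := (norm_nonneg _).trans hW'
  unfold projBall
  split_ifs with h
  · exact le_rfl
  · rw [not_le] at h
    have hW : 0 < ‖W‖ := hB.trans_lt h
    set t := B / ‖W‖ with ht
    have ht1 : t ≤ 1 := (div_le_one hW).2 h.le
    have htB : t * ‖W‖ = B := div_mul_cancel₀ _ hW.ne'
    have h1 : W - W' = (t • W - W') + (1 - t) • W := by module
    have h2 : 0 ≤ ⟪t • W - W', (1 - t) • W⟫ := by
      rw [real_inner_smul_right, inner_sub_left, real_inner_smul_left,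
        real_inner_self_eq_norm_sq]
      refine mul_nonneg (sub_nonneg.2 ht1) ?_
      have h3 := (real_inner_le_norm W' W).trans
        (mul_le_mul_of_nonneg_right hW' hW.le)
      nlinarith
    refine le_of_sq_le_sq ?_ (norm_nonneg _)
    rw [h1, norm_add_sq_real]
    nlinarith [sq_nonneg ‖(1 - t) • W‖]

theorem measurable_projBall (B : ℝ) : Measurable (projBall (n := n) B) := by
  unfold projBall
  refine Measurable.ite (measurableSet_le measurable_norm measurable_const) measurable_id ?_
  exact (measurable_const.div measurable_norm).smul measurable_id

theorem measurable_step (η B : ℝ) :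
    Measurable fun p : Param n × Param n => projBall B (p.1 - η • p.2) :=
  (measurable_projBall B).comp (by fun_prop)

theorem measurable_step_right (η B : ℝ) (W : Param n) :
    Measurable fun g : Param n => projBall B (W - η • g) :=
  (measurable_projBall B).comp (by fun_prop)

/-- One step of projected SGD. -/
def stepKernel (κ : Kernel (Param n) (Param n)) [IsMarkovKernel κ] (η B : ℝ) :
    Kernel (Param n) (Param n) where
  toFun W := (κ W).map fun g => projBall B (W - η • g)
  measurable' := by
    refine Measure.measurable_of_measurable_coe _ fun s hs => ?_
    have h : ∀ W, (κ W).map (fun g => projBall B (W - η • g)) s =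
        κ W (Prod.mk W ⁻¹' ((fun p : Param n × Param n => projBall B (p.1 - η • p.2)) ⁻¹' s)) :=
      fun W => Measure.map_apply (measurable_step_right η B W) hs
    simp only [h]
    exact Kernel.measurable_kernel_prodMk_left (measurable_step η B hs)

section SGD

variable (κ : Kernel (Param n) (Param n)) [IsMarkovKernel κ] {η B : ℝ} {W₀ : Param n}

theorem stepKernel_apply (W : Param n) :
    stepKernel κ η B W = (κ W).map fun g => projBall B (W - η • g) := rfl

instance isMarkovKernel_stepKernel (η B : ℝ) : IsMarkovKernel (stepKernel κ η B) :=
  ⟨fun W => Measure.isProbabilityMeasure_map (measurable_step_right η B W).aemeasurable⟩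

theorem sgdLaw_succ (t : ℕ) :
    sgdLaw κ η B W₀ (t + 1) = (sgdLaw κ η B W₀ t).bind (stepKernel κ η B) := rfl

instance isProbabilityMeasure_sgdLaw (η B : ℝ) (W₀ : Param n) (t : ℕ) :
    IsProbabilityMeasure (sgdLaw κ η B W₀ t) := by
  induction t with
  | zero => exact Measure.dirac.isProbabilityMeasure
  | succ t ih => rw [sgdLaw_succ]; infer_instance

theorem ae_norm_le_stepKernel (hB : 0 ≤ B) (W : Param n) :
    ∀ᵐ W' ∂(stepKernel κ η B W), ‖W'‖ ≤ B := by
  rw [stepKernel_apply, ae_map_iff (measurable_step_right η B W).aemeasurable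
    (measurableSet_le measurable_norm measurable_const)]
  exact Filter.Eventually.of_forall fun g => norm_projBall_le hB _

theorem ae_norm_le_sgdLaw (hW₀ : ‖W₀‖ ≤ B) (t : ℕ) :
    ∀ᵐ W ∂(sgdLaw κ η B W₀ t), ‖W‖ ≤ B := by
  have hB : 0 ≤ B := (norm_nonneg _).trans hW₀
  have hs : MeasurableSet {W : Param n | ¬‖W‖ ≤ B} :=
    (measurableSet_le measurable_norm measurable_const).compl
  cases t with
  | zero =>
    rw [ae_iff, sgdLaw, Measure.dirac_apply' _ hs]
    simpa using hW₀
  | succ t =>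
    rw [ae_iff, sgdLaw_succ, Measure.bind_apply hs (Kernel.aemeasurable _)]
    refine (lintegral_congr fun W => ?_).trans lintegral_zero
    exact ae_iff.1 (ae_norm_le_stepKernel κ hB W)

theorem integral_sgdLaw_succ (hW₀ : ‖W₀‖ ≤ B) {f : Param n → ℝ} (hf : Continuous f) (t : ℕ) :
    ∫ W, f W ∂(sgdLaw κ η B W₀ (t + 1)) =
      ∫ W, ∫ W', f W' ∂(stepKernel κ η B W) ∂(sgdLaw κ η B W₀ t) := by
  have hint := integrable_of_ae_norm_le (ae_norm_le_sgdLaw κ (η := η) hW₀ (t + 1)) hf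
  rw [sgdLaw_succ, Measure.comp_eq_comp_const_apply] at hint ⊢
  rw [ProbabilityTheory.Kernel.integral_comp hint, Kernel.const_apply]

/-- The expected squared distance after an unprojected stochastic gradient step. -/
theorem integral_norm_step_sq {ν : Measure (Param n)} [IsProbabilityMeasure ν]
    (hν : MemLp id 2 ν) (x : Param n) (η : ℝ) :
    Integrable (fun g => ‖x - η • g‖ ^ 2) ν ∧
    ∫ g, ‖x - η • g‖ ^ 2 ∂ν = ‖x‖ ^ 2 - 2 * η * ⟪∫ g, g ∂ν, x⟫
      + η ^ 2 * (‖∫ g, g ∂ν‖ ^ 2 + ∫ g, ‖g - ∫ g', g' ∂ν‖ ^ 2 ∂ν) := by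
  set m := ∫ g, g ∂ν with hm
  have hi : Integrable (fun g : Param n => g) ν := hν.integrable (by norm_num)
  have hd : MemLp (fun g => g - m) 2 ν := hν.sub (memLp_const m)
  have hs : Integrable (fun g => ‖g - m‖ ^ 2) ν := hd.integrable_norm_pow (by norm_num)
  have hdi : Integrable (fun g => g - m) ν := hi.sub (integrable_const m)
  have hc : Integrable (fun g => ⟪x - η • m, g - m⟫) ν := hdi.const_inner _
  have h0 : ∫ g, ⟪x - η • m, g - m⟫ ∂ν = 0 := by
    rw [integral_inner hdi, integral_sub hi (integrable_const m), ← hm]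
    simp
  -- Bias-variance splitting around the mean $m$; the cross term integrates to zero.
  have hexp : ∀ g, ‖x - η • g‖ ^ 2 =
      ‖x - η • m‖ ^ 2 - 2 * η * ⟪x - η • m, g - m⟫ + η ^ 2 * ‖g - m‖ ^ 2 := fun g => by
    have : x - η • g = (x - η • m) - η • (g - m) := by module
    rw [this, norm_sub_sq_real, real_inner_smul_right, norm_smul, mul_pow, Real.norm_eq_abs,
      sq_abs]
    ring
  rw [funext hexp]
  have h1 : Integrable (fun g => ‖x - η • m‖ ^ 2 - 2 * η * ⟪x - η • m, g - m⟫) ν :=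
    (integrable_const _).sub (hc.const_mul _)
  refine ⟨h1.add (hs.const_mul _), ?_⟩
  rw [integral_add h1 (hs.const_mul _), integral_sub (integrable_const _) (hc.const_mul _),
    integral_const_mul, integral_const_mul, h0]
  simp only [integral_const, probReal_univ, one_smul, mul_zero, sub_zero]
  rw [norm_sub_sq_real, real_inner_smul_right, norm_smul, mul_pow, Real.norm_eq_abs, sq_abs,
    real_inner_comm x m]
  ring

variable {F : Param n → ℝ} {V γ S : ℝ} {Wbar : Param n}

/-- Projection does not increase the distance to $\overline W$, and quasar convexity bounds the
drift term. Uniqueness of gradients identifies the oracle's mean with `gradF`. -/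
theorem integral_stepKernel_norm_sub_sq_le (hor : IsGradientOracle κ F B V)
    (hWbar : ‖Wbar‖ ≤ B) {gradF : Param n → Param n}
    (hF : ∀ W, HasGradientAt F (gradF W) W) (hS : ∀ W, ‖W‖ ≤ B → ‖gradF W‖ ≤ S)
    (hη : 0 ≤ η)
    (hqc : ∀ W, ‖W‖ ≤ B → γ * (F W - F Wbar) ≤ ⟪gradF W, W - Wbar⟫)
    {W : Param n} (hW : ‖W‖ ≤ B) :
    ∫ W', ‖W' - Wbar‖ ^ 2 ∂(stepKernel κ η B W) ≤
      ‖W - Wbar‖ ^ 2 - 2 * η * γ * (F W - F Wbar) + η ^ 2 * (S ^ 2 + V) := by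
  obtain ⟨hL, hg, hV⟩ := hor W (mem_closedBall_zero_iff.2 hW)
  have hm : ∫ g, g ∂(κ W) = gradF W := hg.unique (hF W)
  obtain ⟨hint, heq⟩ := integral_norm_step_sq hL (W - Wbar) η
  rw [stepKernel_apply, integral_map (measurable_step_right η B W).aemeasurable
    (by fun_prop)]
  calc _ ≤ ∫ g, ‖W - Wbar - η • g‖ ^ 2 ∂(κ W) := by
        refine integral_mono_of_nonneg (Filter.Eventually.of_forall fun g => by positivity) hint
          (Filter.Eventually.of_forall fun g => ?_)
        have h := norm_projBall_sub_le hWbar (W - η • g)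
        rw [sub_right_comm] at h
        exact pow_le_pow_left₀ (norm_nonneg _) h 2
    _ ≤ _ := by
        rw [heq, hm]
        rw [hm] at hV
        have h1 := mul_le_mul_of_nonneg_left (hqc W hW) (show 0 ≤ 2 * η by linarith)
        have h2 : ‖gradF W‖ ^ 2 ≤ S ^ 2 := pow_le_pow_left₀ (norm_nonneg _) (hS W hW) 2
        have h3 := mul_le_mul_of_nonneg_left (add_le_add h2 hV) (sq_nonneg η)
        linarith

/-- The one-step estimates telescope. The sum starts at $W_1$, whose squared distance to $\overline
W$ is at most that of two points of the ball, $4B^2$. -/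
theorem sum_sgdLaw_le (hor : IsGradientOracle κ F B V)
    (hWbar : ‖Wbar‖ ≤ B) {gradF : Param n → Param n}
    (hF : ∀ W, HasGradientAt F (gradF W) W) (hS : ∀ W, ‖W‖ ≤ B → ‖gradF W‖ ≤ S)
    (hη : 0 ≤ η) (hqc : ∀ W, ‖W‖ ≤ B → γ * (F W - F Wbar) ≤ ⟪gradF W, W - Wbar⟫)
    (hW₀ : ‖W₀‖ ≤ B) (T : ℕ) :
    2 * η * γ * ∑ t ∈ Finset.range T, (∫ W, F W ∂(sgdLaw κ η B W₀ (t + 1)) - F Wbar) ≤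
      4 * B ^ 2 + T * (η ^ 2 * (S ^ 2 + V)) := by
  have hFc : Continuous F := continuous_iff_continuousAt.2 fun W =>
    (hF W).hasFDerivAt.continuousAt
  have hdc : Continuous fun W : Param n => ‖W - Wbar‖ ^ 2 := by fun_prop
  have hiF := fun t => integrable_of_ae_norm_le (ae_norm_le_sgdLaw κ (η := η) hW₀ t) hFc
  have hid := fun t => integrable_of_ae_norm_le (ae_norm_le_sgdLaw κ (η := η) hW₀ t) hdc
  set d := fun t => ∫ W, ‖W - Wbar‖ ^ 2 ∂(sgdLaw κ η B W₀ t) with hd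
  have hstep : ∀ t, d (t + 1) ≤ d t
      - 2 * η * γ * (∫ W, F W ∂(sgdLaw κ η B W₀ t) - F Wbar) + η ^ 2 * (S ^ 2 + V) := by
    intro t
    have hi0 : Integrable (fun W => 2 * η * γ * (F W - F Wbar)) (sgdLaw κ η B W₀ t) :=
      ((hiF t).sub (integrable_const _)).const_mul _
    have hi1 : Integrable (fun W => ‖W - Wbar‖ ^ 2 - 2 * η * γ * (F W - F Wbar))
        (sgdLaw κ η B W₀ t) := (hid t).sub hi0
    simp only [hd]
    rw [integral_sgdLaw_succ κ hW₀ hdc]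
    calc _ ≤ ∫ W, (‖W - Wbar‖ ^ 2 - 2 * η * γ * (F W - F Wbar) + η ^ 2 * (S ^ 2 + V))
          ∂(sgdLaw κ η B W₀ t) := by
          refine integral_mono_of_nonneg
            (Filter.Eventually.of_forall fun W => integral_nonneg fun W' => by positivity)
            (hi1.add (integrable_const _)) ?_
          filter_upwards [ae_norm_le_sgdLaw κ (η := η) hW₀ t] with W hW
          exact integral_stepKernel_norm_sub_sq_le κ hor hWbar hF hS hη hqc hW
      _ = _ := by
          rw [integral_add hi1 (integrable_const _),
            integral_sub (hid t) hi0,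
            integral_const_mul, integral_sub (hiF t) (integrable_const _)]
          simp
  have hd1 : d 1 ≤ 4 * B ^ 2 := by
    calc d 1 ≤ ∫ _W, 4 * B ^ 2 ∂(sgdLaw κ η B W₀ 1) := by
          refine integral_mono_ae (hid 1) (integrable_const _) ?_
          filter_upwards [ae_norm_le_sgdLaw κ (η := η) hW₀ 1] with W hW
          calc ‖W - Wbar‖ ^ 2 ≤ (B + B) ^ 2 := by
                gcongr
                exact (norm_sub_le _ _).trans (add_le_add hW hWbar)
            _ = _ := by ring
      _ = _ := by simp
  have hind : ∀ T : ℕ, d (T + 1) + 2 * η * γ *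
      ∑ t ∈ Finset.range T, (∫ W, F W ∂(sgdLaw κ η B W₀ (t + 1)) - F Wbar) ≤
      d 1 + T * (η ^ 2 * (S ^ 2 + V)) := by
    intro T
    induction T with
    | zero => simp
    | succ T ih =>
      rw [Finset.sum_range_succ, mul_add]
      have := hstep (T + 1)
      push_cast
      linarith
  have hpos : 0 ≤ d (T + 1) := integral_nonneg fun W => by positivity
  linarith [hind T]

/-- The step size keeps the noise of one step below $\eta\gamma\delta$, and the bound on $T$ does
the same for the initial distance per step; dividing by $2\eta\gamma$ leaves $\delta$. The $1$ in
the denominator keeps it positive when $S=V=0$. -/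
theorem sgdValue_le (hor : IsGradientOracle κ F B V) (hV : 0 ≤ V)
    (hWbar : ‖Wbar‖ ≤ B) {gradF : Param n → Param n}
    (hF : ∀ W, HasGradientAt F (gradF W) W) (hS : ∀ W, ‖W‖ ≤ B → ‖gradF W‖ ≤ S)
    (hγ : 0 < γ) (hqc : ∀ W, ‖W‖ ≤ B → γ * (F W - F Wbar) ≤ ⟪gradF W, W - Wbar⟫)
    (hW₀ : ‖W₀‖ ≤ B) {δ : ℝ} (hδ : 0 < δ) {T : ℕ} (hT0 : 0 < T)
    (hT : 4 * B ^ 2 * (S ^ 2 + V + 1) ≤ (γ * δ) ^ 2 * T) :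
    sgdValue κ (γ * δ / (S ^ 2 + V + 1)) B W₀ T F ≤ F Wbar + δ := by
  set Q := S ^ 2 + V + 1 with hQ
  have hQ0 : 0 < Q := by positivity
  set η := γ * δ / Q with hη
  have hη0 : 0 < η := by positivity
  have hT' : (0 : ℝ) < T := by exact_mod_cast hT0
  have h := sum_sgdLaw_le κ (η := η) hor hWbar hF hS hη0.le hqc hW₀ T
  rw [Finset.sum_sub_distrib, Finset.sum_const, Finset.card_range, nsmul_eq_mul] at h
  set A := ∑ t ∈ Finset.range T, ∫ W, F W ∂(sgdLaw κ η B W₀ (t + 1)) with hA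
  have h1 : 4 * B ^ 2 ≤ η * γ * δ * T := by
    have : η * γ * δ * T = (γ * δ) ^ 2 * T / Q := by rw [hη]; ring
    rw [this, le_div_iff₀ hQ0]
    exact hT
  have h2 : η ^ 2 * (S ^ 2 + V) ≤ η * γ * δ := by
    calc η ^ 2 * (S ^ 2 + V) ≤ η ^ 2 * Q := by gcongr; linarith
      _ = η * (η * Q) := by ring
      _ = η * γ * δ := by rw [hη, div_mul_cancel₀ _ hQ0.ne']; ring
  have h3 : 2 * η * γ * (A - T * F Wbar) ≤ 2 * η * γ * (T * δ) := by
    have := mul_le_mul_of_nonneg_left h2 hT'.le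
    linarith
  have h4 := le_of_mul_le_mul_left h3 (by positivity)
  rw [sgdValue, div_le_iff₀ hT']
  linarith

theorem sgdValue_mono (hW₀ : ‖W₀‖ ≤ B) {f g : Param n → ℝ} (hf : Continuous f)
    (hg : Continuous g) {C : ℝ} (hfg : ∀ W, f W ≤ g W + C) {T : ℕ} (hT0 : 0 < T) :
    sgdValue κ η B W₀ T f ≤ sgdValue κ η B W₀ T g + C := by
  have hT' : (0 : ℝ) < T := by exact_mod_cast hT0
  have h : ∀ t, ∫ W, f W ∂(sgdLaw κ η B W₀ t) ≤ ∫ W, g W ∂(sgdLaw κ η B W₀ t) + C := by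
    intro t
    have hi := integrable_of_ae_norm_le (ae_norm_le_sgdLaw κ (η := η) hW₀ t) hg
    calc _ ≤ ∫ W, (g W + C) ∂(sgdLaw κ η B W₀ t) :=
          integral_mono (integrable_of_ae_norm_le (ae_norm_le_sgdLaw κ hW₀ t) hf)
            (hi.add (integrable_const _)) hfg
      _ = _ := by rw [integral_add hi (integrable_const _)]; simp
  unfold sgdValue
  rw [div_add' _ _ _ hT'.ne', div_le_div_iff_of_pos_right hT']
  calc _ ≤ ∑ t ∈ Finset.range T, (∫ W, g W ∂(sgdLaw κ η B W₀ (t + 1)) + C) :=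
        Finset.sum_le_sum fun t _ => h (t + 1)
    _ = _ := by rw [Finset.sum_add_distrib]; simp [mul_comm]

end SGD

end TSPGenerator

end

noncomputable section

namespace TSPGenerator

variable {n : ℕ}

/-! ### Identification of parameters by bits -/

/-- A net of the ball given by a grid with cells of side `h`. -/
theorem exists_decoder {B h : ℝ} (hB : 0 ≤ B) (hh : 0 < h) {b : ℕ} (hb : 2 * B / h < 2 ^ b) :
    ∃ dec : (Fin (n * n * (n * n) * b) → Bool) → Param n,
      (∀ x, dec x ∈ Metric.closedBall (0 : Param n) B) ∧
      ∀ W ∈ Metric.closedBall (0 : Param n) B, ∃ x, ‖dec x - W‖ ≤ (n : ℝ) ^ 2 * h := by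
  classical
  obtain ⟨e⟩ : Nonempty (((Fin n × Fin n) × (Fin n × Fin n) → Fin (2 ^ b)) ≃
      (Fin (n * n * (n * n) * b) → Bool)) := by
    refine Fintype.card_eq.1 ?_
    simp only [Fintype.card_fun, Fintype.card_prod, Fintype.card_fin, Fintype.card_bool]
    rw [← pow_mul, mul_comm b]
  -- `Fin.ofNat` reduces modulo $2^b$, but `hb` keeps the indices of points of the ball below $2^b$.
  set cell : Param n → (Fin n × Fin n) × (Fin n × Fin n) → Fin (2 ^ b) := fun W i =>
    Fin.ofNat (2 ^ b) ⌊(W i + B) / h⌋₊ with hcell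
  -- A string decodes to some point of the ball in its cell rather than to a grid point, which could
  -- lie outside the ball; unused strings decode to $0$.
  set dec : (Fin (n * n * (n * n) * b) → Bool) → Param n := fun x =>
    if hx : ∃ W ∈ Metric.closedBall (0 : Param n) B, e (cell W) = x then hx.choose else 0
    with hdec
  have hmem : ∀ x, dec x ∈ Metric.closedBall (0 : Param n) B := fun x => by
    simp only [hdec]
    split_ifs with hx
    · exact hx.choose_spec.1
    · exact Metric.mem_closedBall_self hB
  refine ⟨dec, hmem, fun W hW => ⟨e (cell W), ?_⟩⟩
  have hx : ∃ W' ∈ Metric.closedBall (0 : Param n) B, e (cell W') = e (cell W) := ⟨W, hW, rfl⟩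
  have hsame : cell (dec (e (cell W))) = cell W := by
    have h1 : dec (e (cell W)) = hx.choose := by simp only [hdec, dif_pos hx]
    rw [h1]
    exact e.injective hx.choose_spec.2
  have hcoord : ∀ W' ∈ Metric.closedBall (0 : Param n) B, ∀ i,
      0 ≤ (W' i + B) / h ∧ ((cell W' i : ℕ) : ℝ) ≤ (W' i + B) / h ∧
        (W' i + B) / h < (cell W' i : ℕ) + 1 := fun W' hW' i => by
    have h1 : |W' i| ≤ B :=
      (PiLp.norm_apply_le W' i).trans (mem_closedBall_zero_iff.1 hW')
    obtain ⟨h2, h3⟩ := abs_le.1 h1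
    have h4 : 0 ≤ (W' i + B) / h := div_nonneg (by linarith) hh.le
    have h5 : ⌊(W' i + B) / h⌋₊ < 2 ^ b := by
      rw [Nat.floor_lt h4]
      push_cast
      refine lt_of_le_of_lt ?_ hb
      gcongr
      linarith
    have h6 : (cell W' i : ℕ) = ⌊(W' i + B) / h⌋₊ := by
      simp only [hcell, Fin.ofNat, Nat.mod_eq_of_lt h5]
    rw [h6]
    exact ⟨h4, Nat.floor_le h4, Nat.lt_floor_add_one _⟩
  set W' := dec (e (cell W)) with hW'
  have hdist : ∀ i, ‖(W' - W) i‖ ^ 2 ≤ h ^ 2 := fun i => by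
    obtain ⟨-, a1, a2⟩ := hcoord W' (hmem _) i
    obtain ⟨-, b1, b2⟩ := hcoord W hW i
    rw [hsame] at a1 a2
    rw [div_lt_iff₀ hh] at a2 b2
    rw [le_div_iff₀ hh] at a1 b1
    rw [Real.norm_eq_abs, sq_abs]
    refine sq_le_sq' ?_ ?_ <;> simp only [PiLp.sub_apply] <;> linarith
  refine le_of_sq_le_sq ?_ (by positivity)
  rw [EuclideanSpace.norm_sq_eq]
  calc _ ≤ ∑ _i : (Fin n × Fin n) × (Fin n × Fin n), h ^ 2 :=
        Finset.sum_le_sum fun i _ => hdist i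
    _ = _ := by
        simp only [Finset.sum_const, Finset.card_univ, Fintype.card_prod, Fintype.card_fin,
          nsmul_eq_mul]
        push_cast
        ring

/-- One factor $e^u$ comes from the numerator, the other from the partition function. -/
theorem gibbs_le_exp_mul_gibbs {W W' : Param n} {E : Mat n} {u : ℝ}
    (hu : ∀ σ, |score W' E σ - score W E σ| ≤ u) (σ : Tour n) :
    gibbs W' E σ ≤ Real.exp (2 * u) * gibbs W E σ := by
  have h1 : Real.exp (score W' E σ) ≤ Real.exp u * Real.exp (score W E σ) := by
    rw [← Real.exp_add]
    exact Real.exp_le_exp.2 (by linarith [le_of_abs_le (hu σ)])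
  have h2 : partition W E ≤ Real.exp u * partition W' E := by
    simp only [partition, Finset.mul_sum]
    refine Finset.sum_le_sum fun τ _ => ?_
    rw [← Real.exp_add]
    exact Real.exp_le_exp.2 (by linarith [neg_le_of_abs_le (hu τ)])
  rw [gibbs_eq, gibbs_eq, mul_div_assoc', div_le_div_iff₀ (partition_pos _ _)
    (partition_pos _ _)]
  calc _ ≤ (Real.exp u * Real.exp (score W E σ)) * (Real.exp u * partition W' E) := by
        gcongr
        exact (partition_pos _ _).le
    _ = _ := by rw [two_mul, Real.exp_add]; ring

theorem sum_abs_gibbs_sub_le {W W' : Param n} {E : Mat n} {u : ℝ}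
    (hu : ∀ σ, |score W' E σ - score W E σ| ≤ u) (hu1 : 2 * u ≤ 1) :
    ∑ σ, |gibbs W' E σ - gibbs W E σ| ≤ 8 * u := by
  have hu0 : 0 ≤ u := (abs_nonneg _).trans (hu (Classical.arbitrary _))
  have hexp : Real.exp (2 * u) - 1 ≤ 4 * u := by
    have h := Real.abs_exp_sub_one_le (x := 2 * u) (by rwa [abs_of_nonneg (by positivity)])
    rw [abs_of_nonneg (show 0 ≤ 2 * u by positivity)] at h
    linarith [le_of_abs_le h]
  have h : ∀ σ, |gibbs W' E σ - gibbs W E σ| ≤ 4 * u * gibbs W E σ + 4 * u * gibbs W' E σ :=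
    fun σ => by
      have h1 := gibbs_le_exp_mul_gibbs hu σ
      have h2 := gibbs_le_exp_mul_gibbs (W := W') (W' := W)
        (fun τ => by rw [abs_sub_comm]; exact hu τ) σ
      have h3 := mul_le_mul_of_nonneg_right hexp (gibbs_pos W E σ).le
      have h4 := mul_le_mul_of_nonneg_right hexp (gibbs_pos W' E σ).le
      have h5 := mul_nonneg hu0 (gibbs_pos W E σ).le
      have h6 := mul_nonneg hu0 (gibbs_pos W' E σ).le
      rw [abs_le]
      constructor <;> linarith
  calc _ ≤ ∑ σ, (4 * u * gibbs W E σ + 4 * u * gibbs W' E σ) :=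
        Finset.sum_le_sum fun σ _ => h σ
    _ = _ := by
        rw [Finset.sum_add_distrib, ← Finset.mul_sum, ← Finset.mul_sum, sum_gibbs, sum_gibbs]
        ring

/-- Neighbours differ in score by at most $u=n^2h\,D(n+1)$, and total variation is half of the
$\ell^1$ distance $8u$. The slow component is no worse since $\rho\le1$. -/
theorem identifiedByBits {β ρ B D δ h : ℝ} (hβ0 : 0 ≤ β) (hβ1 : β ≤ 1) (hρ0 : 0 ≤ ρ)
    (hρ1 : ρ ≤ 1) (hB : 0 ≤ B) (hD : 0 ≤ D) (hh : 0 < h) (hδ : (n : ℝ) ^ 2 * h ≤ δ)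
    (hδ' : 4 * ((n : ℝ) ^ 2 * h * (D * (n + 1))) ≤ δ)
    (h1 : 2 * ((n : ℝ) ^ 2 * h * (D * (n + 1))) ≤ 1) {b : ℕ} (hb : 2 * B / h < 2 ^ b) :
    IdentifiedByBits n β ρ B D δ (n * n * (n * n) * b) := by
  obtain ⟨dec, hmem, hdec⟩ := exists_decoder (n := n) hB hh hb
  refine ⟨dec, hmem, fun W hW => ?_⟩
  obtain ⟨x, hx⟩ := hdec W hW
  refine ⟨x, hx.trans hδ, fun E hE => ?_⟩
  set u := (n : ℝ) ^ 2 * h * (D * (n + 1)) with hu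
  have hu0 : 0 ≤ u := by positivity
  have hsc : ∀ σ, |score (dec x) E σ - score W E σ| ≤ u := fun σ => by
    rw [← score_sub]
    refine (abs_score_le _ _ _).trans ?_
    rw [hu]
    gcongr
  have hscρ : ∀ σ, |score (ρ • dec x) E σ - score (ρ • W) E σ| ≤ u := fun σ => by
    rw [score_smul, score_smul, ← mul_sub, abs_mul, abs_of_nonneg hρ0]
    calc _ ≤ 1 * u := mul_le_mul hρ1 (hsc σ) (abs_nonneg _) zero_le_one
      _ = u := one_mul u
  have h2 := sum_abs_gibbs_sub_le hsc h1
  have h3 := sum_abs_gibbs_sub_le hscρ h1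
  have h4 : ∑ σ : Tour n, |generator β ρ (dec x) E σ - generator β ρ W E σ| ≤ 8 * u := by
    calc _ ≤ ∑ σ : Tour n, ((1 - β) * |gibbs (dec x) E σ - gibbs W E σ|
          + β * |gibbs (ρ • dec x) E σ - gibbs (ρ • W) E σ|) := by
          refine Finset.sum_le_sum fun σ _ => ?_
          have : generator β ρ (dec x) E σ - generator β ρ W E σ =
              (1 - β) * (gibbs (dec x) E σ - gibbs W E σ)
                + β * (gibbs (ρ • dec x) E σ - gibbs (ρ • W) E σ) := by
            unfold generator; ring
          rw [this]
          refine (abs_add_le _ _).trans_eq ?_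
          rw [abs_mul, abs_mul, abs_of_nonneg hβ0, abs_of_nonneg (sub_nonneg.2 hβ1)]
      _ ≤ (1 - β) * (8 * u) + β * (8 * u) := by
          rw [Finset.sum_add_distrib, ← Finset.mul_sum, ← Finset.mul_sum]
          exact add_le_add (mul_le_mul_of_nonneg_left h2 (sub_nonneg.2 hβ1))
            (mul_le_mul_of_nonneg_left h3 hβ0)
      _ = _ := by ring
  linarith

/-! ### Polynomial bounds -/

/-- `f` is bounded by a polynomial in `P`. -/
def PolyBounded {ι : Type*} (P f : ι → ℝ) : Prop := ∃ c : ℕ, ∀ i, |f i| ≤ c * P i ^ c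

section PolyBounded

variable {ι : Type*} {P f g : ι → ℝ}

theorem PolyBounded.of_abs_le (hg : PolyBounded P g) (h : ∀ i, |f i| ≤ |g i|) :
    PolyBounded P f := by
  obtain ⟨c, hc⟩ := hg
  exact ⟨c, fun i => (h i).trans (hc i)⟩

theorem PolyBounded.of_le (hg : PolyBounded P g) (h0 : ∀ i, 0 ≤ f i) (h : ∀ i, f i ≤ g i) :
    PolyBounded P f :=
  hg.of_abs_le fun i => abs_le_abs_of_nonneg (h0 i) (h i)

theorem PolyBounded.add (hP : ∀ i, 1 ≤ P i) (hf : PolyBounded P f) (hg : PolyBounded P g) :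
    PolyBounded P fun i => f i + g i := by
  obtain ⟨c, hc⟩ := hf
  obtain ⟨d, hd⟩ := hg
  refine ⟨c + d, fun i => ?_⟩
  calc |f i + g i| ≤ c * P i ^ c + d * P i ^ d :=
        (abs_add_le _ _).trans (add_le_add (hc i) (hd i))
    _ ≤ c * P i ^ (c + d) + d * P i ^ (c + d) := by
        gcongr
        · exact hP i
        · omega
        · exact hP i
        · omega
    _ = _ := by push_cast; ring

theorem PolyBounded.mul (hP : ∀ i, 1 ≤ P i) (hf : PolyBounded P f) (hg : PolyBounded P g) :
    PolyBounded P fun i => f i * g i := by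
  obtain ⟨c, hc⟩ := hf
  obtain ⟨d, hd⟩ := hg
  -- One number serves as coefficient and exponent, so it must dominate both $cd$ and $c+d$.
  refine ⟨c * d + (c + d), fun i => ?_⟩
  have hP0 : 0 ≤ P i := zero_le_one.trans (hP i)
  calc |f i * g i| ≤ (c * P i ^ c) * (d * P i ^ d) := by
        rw [abs_mul]
        exact mul_le_mul (hc i) (hd i) (abs_nonneg _) (by positivity)
    _ = ((c * d : ℕ) : ℝ) * P i ^ (c + d) := by push_cast; ring
    _ ≤ _ := mul_le_mul (Nat.cast_le.2 (Nat.le_add_right _ _))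
        (pow_le_pow_right₀ (hP i) (Nat.le_add_left _ _)) (by positivity) (Nat.cast_nonneg _)

theorem PolyBounded.const (hP : ∀ i, 1 ≤ P i) (a : ℝ) : PolyBounded P fun _ => a :=
  ⟨⌈|a|⌉₊, fun i => (Nat.le_ceil _).trans
    (le_mul_of_one_le_right (Nat.cast_nonneg _) (one_le_pow₀ (hP i)))⟩

theorem PolyBounded.base (hf0 : ∀ i, 0 ≤ f i) (hf : ∀ i, f i ≤ P i) :
    PolyBounded P f :=
  ⟨1, fun i => by simpa [abs_of_nonneg (hf0 i)] using hf i⟩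

theorem PolyBounded.pow (hP : ∀ i, 1 ≤ P i) (hf : PolyBounded P f) (k : ℕ) :
    PolyBounded P fun i => f i ^ k := by
  induction k with
  | zero => simpa using PolyBounded.const hP 1
  | succ k ih => simpa only [pow_succ] using ih.mul hP hf

theorem size_le {k : ℕ} {x : ℝ} (hx : 1 ≤ x) (hk : (k : ℝ) ≤ x) :
    (Nat.size k : ℝ) ≤ 1 + 2 * Real.log x := by
  have hlog : 0 ≤ Real.log x := Real.log_nonneg hx
  rcases Nat.eq_zero_or_pos (Nat.size k) with h | h
  · rw [h]; push_cast; linarith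
  · have h1 : 2 ^ (Nat.size k - 1) ≤ k := Nat.lt_size.1 (by omega)
    have h2 : (2 : ℝ) ^ (Nat.size k - 1) ≤ x := le_trans (by exact_mod_cast h1) hk
    have h3 := Real.log_le_log (by positivity) h2
    rw [Real.log_pow, Nat.cast_sub h, Nat.cast_one] at h3
    have h4 : (1 : ℝ) / 2 ≤ Real.log 2 := by linarith [Real.log_two_gt_d9]
    have h5 : (0 : ℝ) ≤ (Nat.size k : ℝ) - 1 := by
      have : (1 : ℝ) ≤ Nat.size k := by exact_mod_cast h
      linarith
    have h6 := mul_le_mul_of_nonneg_left h4 h5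
    linarith

/-- The number of digits of a polynomially bounded number is bounded by a polynomial in a bound
for the logarithm. -/
theorem PolyBounded.size {P' : ι → ℝ} (hP : ∀ i, 1 ≤ P i) (hP' : ∀ i, 1 ≤ P' i)
    (hlog : ∀ i, Real.log (P i) ≤ 2 * P' i) {k : ι → ℕ} (hk : PolyBounded P fun i => (k i : ℝ)) :
    PolyBounded P' fun i => (Nat.size (k i) : ℝ) := by
  obtain ⟨c, hc⟩ := hk
  have hb : PolyBounded P' fun i => ((1 + 2 * (c + 1) : ℕ) : ℝ) + ((4 * c : ℕ) : ℝ) * P' i :=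
    (PolyBounded.const hP' _).add hP' ((PolyBounded.const hP' _).mul hP'
      (PolyBounded.base (fun i => zero_le_one.trans (hP' i)) fun i => le_rfl))
  refine hb.of_le (fun i => Nat.cast_nonneg _) fun i => ?_
  have hP0 : 0 < P i := zero_lt_one.trans_le (hP i)
  have h1 : (k i : ℝ) ≤ ((c : ℝ) + 1) * P i ^ c := by
    have h := hc i
    rw [Nat.abs_cast] at h
    refine h.trans ?_
    gcongr
    linarith
  have h2 : (1 : ℝ) ≤ ((c : ℝ) + 1) * P i ^ c := by
    have h3 : (1 : ℝ) ≤ P i ^ c := one_le_pow₀ (hP i)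
    have h4 : (0 : ℝ) ≤ c := Nat.cast_nonneg c
    nlinarith
  have h3 := size_le h2 h1
  rw [Real.log_mul (by positivity) (by positivity), Real.log_pow] at h3
  have h4 : Real.log ((c : ℝ) + 1) ≤ c + 1 := Real.log_le_self (by positivity)
  have h5 := mul_le_mul_of_nonneg_left (hlog i) (Nat.cast_nonneg c : (0 : ℝ) ≤ c)
  push_cast
  linarith

end PolyBounded

end TSPGenerator

end

noncomputable section

namespace TSPGenerator

open scoped RealInnerProductSpace

/-! ### The parameters of the generator family -/

/-- An integer exceeding the reciprocal of the accuracy. -/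
def precision (ε : ℝ) : ℕ := ⌈1 / ε⌉₊ + 1

/-- The bound on the norms of instances and cost weights. -/
def normBound (K n : ℕ) : ℕ := K * (n + 1) ^ K

/-- The radius of the parameter ball. -/
def radius (K n : ℕ) (ε : ℝ) : ℕ := 8 * normBound K n * (n + 1) ^ 2 * precision ε + 1

/-- The reciprocal of the slow scale, and of the weight of the slow component. -/
def invScale (K n : ℕ) (ε : ℝ) : ℕ := 4 * radius K n ε * (normBound K n + 1) * (n + 1)

/-- The reciprocal of the side of the grid cells. -/
def gridSize (K n : ℕ) (ε : ℝ) : ℕ := 4 * precision ε * (normBound K n + 1) * (n + 1) ^ 3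

/-- The weight of the regularizer. -/
def regWeight (n : ℕ) (ε : ℝ) : ℝ := (8 * ((n : ℝ) + 1) ^ 2 * precision ε)⁻¹

/-- An integer bound on the norm of policy gradient samples. -/
def sampleSize (K n : ℕ) (ε : ℝ) : ℕ :=
  ((n + 1) ^ 2 + 3 * (radius K n ε * (normBound K n * (n + 1)))) *
    (2 * (normBound K n * (n + 1)))

/-- The reciprocal of the quasar convexity constant. -/
def invQuasar (K n : ℕ) (ε : ℝ) : ℕ := 8 * (n + 1) ^ 8 * invScale K n ε ^ 2

/-- A lower bound on the number of steps of projected SGD. -/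
def stepBound (K n : ℕ) (ε V : ℝ) : ℝ :=
  4 * (radius K n ε : ℝ) ^ 2 * ((sampleSize K n ε : ℝ) ^ 2 + V + 1) *
    (invQuasar K n ε * (2 * precision ε)) ^ 2

/-- The data in which the bounds are polynomial: number of nodes, accuracy, oracle variance. -/
structure Setting where
  /-- The number of nodes. -/
  n : ℕ
  /-- The accuracy. -/
  ε : ℝ
  /-- The variance of the oracle. -/
  V : ℝ
  ε_pos : 0 < ε
  V_nonneg : 0 ≤ V

/-- The base of the polynomial bounds. -/
def Setting.poly (i : Setting) : ℝ := ((i.n : ℝ) + 1) * (1 + 1 / i.ε) * (1 + i.V)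

/-- The base of the polynomial bounds on bit complexity. -/
def Setting.bits (i : Setting) : ℝ := ((i.n : ℝ) + 1) * (1 + Real.log (1 + 1 / i.ε))

/-! ### Polynomial bounds for the chosen parameters. -/

namespace Setting

theorem one_le_size (i : Setting) : 1 ≤ (i.n : ℝ) + 1 := by
  linarith [(Nat.cast_nonneg i.n : (0 : ℝ) ≤ i.n)]

theorem one_le_inv (i : Setting) : 1 ≤ 1 + 1 / i.ε := by
  have := one_div_pos.2 i.ε_pos
  linarith

theorem one_le_var (i : Setting) : 1 ≤ 1 + i.V := by linarith [i.V_nonneg]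

theorem one_le_log (i : Setting) : 1 ≤ 1 + Real.log (1 + 1 / i.ε) := by
  linarith [Real.log_nonneg i.one_le_inv]

theorem one_le_poly (i : Setting) : 1 ≤ i.poly :=
  one_le_mul_of_one_le_of_one_le
    (one_le_mul_of_one_le_of_one_le i.one_le_size i.one_le_inv) i.one_le_var

theorem one_le_bits (i : Setting) : 1 ≤ i.bits :=
  one_le_mul_of_one_le_of_one_le i.one_le_size i.one_le_log

theorem size_le_poly (i : Setting) : (i.n : ℝ) + 1 ≤ i.poly := by
  have h := i.one_le_size
  unfold poly
  rw [mul_assoc]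
  exact le_mul_of_one_le_right (by linarith)
    (one_le_mul_of_one_le_of_one_le i.one_le_inv i.one_le_var)

theorem inv_le_poly (i : Setting) : 1 + 1 / i.ε ≤ i.poly := by
  have h := i.one_le_inv
  have h' := i.one_le_size
  unfold poly
  calc 1 + 1 / i.ε = 1 * (1 + 1 / i.ε) * 1 := by ring
    _ ≤ _ := by
      gcongr
      exact i.one_le_var

theorem var_le_poly (i : Setting) : 1 + i.V ≤ i.poly := by
  have h := i.one_le_var
  exact le_mul_of_one_le_left (by linarith)
    (one_le_mul_of_one_le_of_one_le i.one_le_size i.one_le_inv)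

theorem polyBounded_size : PolyBounded poly fun i => (i.n : ℝ) + 1 :=
  PolyBounded.base (fun i => zero_le_one.trans i.one_le_size) size_le_poly

theorem polyBounded_var : PolyBounded poly fun i => i.V :=
  PolyBounded.base V_nonneg fun i => by linarith [i.var_le_poly]

theorem polyBounded_precision : PolyBounded poly fun i => (precision i.ε : ℝ) := by
  have h : PolyBounded poly fun i => 2 * (1 + 1 / i.ε) :=
    (PolyBounded.const one_le_poly 2).mul one_le_poly
      (PolyBounded.base (fun i => zero_le_one.trans i.one_le_inv) inv_le_poly)
  refine h.of_le (fun i => Nat.cast_nonneg _) fun i => ?_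
  have h0 := one_div_pos.2 i.ε_pos
  have h1 := Nat.ceil_lt_add_one h0.le
  unfold precision
  push_cast
  linarith

variable (K : ℕ)

theorem polyBounded_normBound : PolyBounded poly fun i => (normBound K i.n : ℝ) := by
  unfold normBound
  push_cast
  exact (PolyBounded.const one_le_poly _).mul one_le_poly
    (polyBounded_size.pow one_le_poly K)

theorem polyBounded_radius : PolyBounded poly fun i => (radius K i.n i.ε : ℝ) := by
  unfold radius
  push_cast
  exact ((((PolyBounded.const one_le_poly _).mul one_le_poly (polyBounded_normBound K)).mul
    one_le_poly (polyBounded_size.pow one_le_poly 2)).mul one_le_poly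
      polyBounded_precision).add one_le_poly (PolyBounded.const one_le_poly 1)

theorem polyBounded_invScale : PolyBounded poly fun i => (invScale K i.n i.ε : ℝ) := by
  unfold invScale
  push_cast
  exact (((PolyBounded.const one_le_poly _).mul one_le_poly (polyBounded_radius K)).mul
    one_le_poly ((polyBounded_normBound K).add one_le_poly
      (PolyBounded.const one_le_poly 1))).mul one_le_poly polyBounded_size

theorem polyBounded_gridSize : PolyBounded poly fun i => (gridSize K i.n i.ε : ℝ) := by
  unfold gridSize
  push_cast
  exact (((PolyBounded.const one_le_poly _).mul one_le_poly polyBounded_precision).mul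
    one_le_poly ((polyBounded_normBound K).add one_le_poly
      (PolyBounded.const one_le_poly 1))).mul one_le_poly (polyBounded_size.pow one_le_poly 3)

theorem polyBounded_sampleSize : PolyBounded poly fun i => (sampleSize K i.n i.ε : ℝ) := by
  have h := (polyBounded_normBound K).mul one_le_poly polyBounded_size
  unfold sampleSize
  push_cast
  exact ((polyBounded_size.pow one_le_poly 2).add one_le_poly
    ((PolyBounded.const one_le_poly _).mul one_le_poly
      ((polyBounded_radius K).mul one_le_poly h))).mul one_le_poly
    ((PolyBounded.const one_le_poly _).mul one_le_poly h)

theorem polyBounded_invQuasar : PolyBounded poly fun i => (invQuasar K i.n i.ε : ℝ) := by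
  unfold invQuasar
  push_cast
  exact ((PolyBounded.const one_le_poly _).mul one_le_poly
    (polyBounded_size.pow one_le_poly 8)).mul one_le_poly
      ((polyBounded_invScale K).pow one_le_poly 2)

theorem polyBounded_variance :
    PolyBounded poly fun i => 4 * (sampleSize K i.n i.ε : ℝ) ^ 2 :=
  (PolyBounded.const one_le_poly _).mul one_le_poly
    ((polyBounded_sampleSize K).pow one_le_poly 2)

theorem stepBound_nonneg (i : Setting) : 0 ≤ stepBound K i.n i.ε i.V := by
  have := i.V_nonneg
  unfold stepBound
  positivity

theorem polyBounded_steps :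
    PolyBounded poly fun i => ((⌈stepBound K i.n i.ε i.V⌉₊ + 1 : ℕ) : ℝ) := by
  have h : PolyBounded poly fun i => stepBound K i.n i.ε i.V := by
    unfold stepBound
    exact (((PolyBounded.const one_le_poly _).mul one_le_poly
      ((polyBounded_radius K).pow one_le_poly 2)).mul one_le_poly
        ((((polyBounded_sampleSize K).pow one_le_poly 2).add one_le_poly polyBounded_var).add
          one_le_poly (PolyBounded.const one_le_poly 1))).mul one_le_poly
        (((polyBounded_invQuasar K).mul one_le_poly
          ((PolyBounded.const one_le_poly _).mul one_le_poly polyBounded_precision)).pow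
            one_le_poly 2)
  refine (h.add one_le_poly (PolyBounded.const one_le_poly 2)).of_le
    (fun i => Nat.cast_nonneg _) fun i => ?_
  have h1 := Nat.ceil_lt_add_one (stepBound_nonneg K i)
  push_cast
  linarith

theorem log_poly_le (i : Setting) (hV : i.V = 0) : Real.log i.poly ≤ 2 * i.bits := by
  have h1 := i.one_le_size
  have h2 := i.one_le_inv
  have h3 := i.one_le_log
  unfold poly bits
  rw [hV, add_zero, mul_one, Real.log_mul (by linarith) (by linarith)]
  have h4 : Real.log ((i.n : ℝ) + 1) ≤ i.n + 1 := Real.log_le_self (by linarith)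
  nlinarith

/-- The length of the description of the generator family. -/
theorem exists_bits_bound : ∃ c : ℕ, ∀ (n : ℕ) (ε : ℝ), 0 < ε →
    ((n * n * (n * n) * Nat.size (2 * radius K n ε * gridSize K n ε)
      + ratBits ((invScale K n ε : ℚ)⁻¹) + ratBits ((invScale K n ε : ℚ)⁻¹)
      + ratBits (radius K n ε : ℚ) : ℕ) : ℝ) ≤
      c * ((n : ℝ) + 1) ^ c * (1 + Real.log (1 + 1 / ε)) ^ c := by
  -- The description does not involve the oracle variance, so the polynomial bounds are restricted
  -- to $V=0$, where `log_poly_le` applies.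
  set e : {i : Setting // i.V = 0} → Setting := Subtype.val with he
  have hP : ∀ i, 1 ≤ (e i).poly := fun i => (e i).one_le_poly
  have hP' : ∀ i, 1 ≤ (e i).bits := fun i => (e i).one_le_bits
  have hres : ∀ f : Setting → ℝ, PolyBounded poly f →
      PolyBounded (fun i => (e i).poly) fun i => f (e i) := fun f ⟨c, hc⟩ =>
    ⟨c, fun i => hc (e i)⟩
  have hsize : ∀ k : Setting → ℕ, (PolyBounded poly fun i => (k i : ℝ)) →
      PolyBounded (fun i => (e i).bits) fun i => (Nat.size (k (e i)) : ℝ) := fun k hk =>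
    (hres _ hk).size hP hP' fun i => (e i).log_poly_le i.2
  have hn : PolyBounded (fun i => (e i).bits) fun i => ((e i).n : ℝ) := by
    refine PolyBounded.base (fun i => Nat.cast_nonneg _) fun i => ?_
    have h1 := (e i).one_le_size
    have h2 := (e i).one_le_log
    unfold bits
    nlinarith
  have hg : PolyBounded poly fun i : Setting =>
      ((2 * radius K i.n i.ε * gridSize K i.n i.ε : ℕ) : ℝ) := by
    push_cast
    exact ((PolyBounded.const one_le_poly _).mul one_le_poly (polyBounded_radius K)).mul
      one_le_poly (polyBounded_gridSize K)
  have h1 := hsize _ hg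
  have h2 := hsize _ (polyBounded_invScale K)
  have h3 := hsize _ (polyBounded_radius K)
  have hc1 := PolyBounded.const hP' 1
  have hnn := hn.mul hP' hn
  obtain ⟨c, hc⟩ := ((((hnn.mul hP' hnn).mul hP' h1).add hP' (hc1.add hP' h2)).add hP'
    (hc1.add hP' h2)).add hP' (h3.add hP' hc1)
  refine ⟨c, fun n ε hε => ?_⟩
  have h := (le_abs_self _).trans (hc ⟨⟨n, ε, 0, hε, le_rfl⟩, rfl⟩)
  simp only [he, bits, mul_pow, ← mul_assoc] at h
  refine le_trans (le_of_eq ?_) h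
  have hr : 0 < invScale K n ε := by unfold invScale radius; positivity
  simp only [ratBits, Rat.inv_natCast_num_of_pos hr, Rat.inv_natCast_den_of_pos hr,
    Rat.num_natCast, Rat.den_natCast, Int.natAbs_natCast, Int.natAbs_one, Nat.size_one]
  push_cast
  ring

theorem exists_variance_bound : ∃ c : ℕ, ∀ (n : ℕ) (ε : ℝ), 0 < ε →
    4 * (sampleSize K n ε : ℝ) ^ 2 ≤ c * ((n : ℝ) + 1) ^ c * (1 + 1 / ε) ^ c := by
  obtain ⟨c, hc⟩ := polyBounded_variance K
  refine ⟨c, fun n ε hε => ?_⟩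
  have h := (le_abs_self _).trans (hc ⟨n, ε, 0, hε, le_rfl⟩)
  simpa only [poly, mul_pow, ← mul_assoc, add_zero, mul_one, one_pow] using h

theorem exists_steps_bound : ∃ c : ℕ, ∀ (n : ℕ) (ε V : ℝ), 0 < ε → 0 ≤ V →
    ((⌈stepBound K n ε V⌉₊ + 1 : ℕ) : ℝ) ≤
      c * ((n : ℝ) + 1) ^ c * (1 + 1 / ε) ^ c * (1 + V) ^ c := by
  obtain ⟨c, hc⟩ := polyBounded_steps K
  refine ⟨c, fun n ε V hε hV => ?_⟩
  have h := (le_abs_self _).trans (hc ⟨n, ε, V, hε, hV⟩)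
  simpa only [poly, mul_pow, ← mul_assoc] using h

end Setting

/-! ### Adequacy of the chosen parameters. -/

section Parameters

variable (K n : ℕ) {ε : ℝ}

theorem one_le_precision (ε : ℝ) : 1 ≤ (precision ε : ℝ) := by
  unfold precision; push_cast; linarith [(Nat.cast_nonneg ⌈1 / ε⌉₊ : (0 : ℝ) ≤ _)]

theorem inv_precision_le (hε : 0 < ε) : (precision ε : ℝ)⁻¹ ≤ ε := by
  refine inv_le_of_inv_le₀ hε ?_
  have := Nat.le_ceil (1 / ε)
  unfold precision
  push_cast
  rw [← one_div]
  linarith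

theorem regWeight_pos (ε : ℝ) : 0 < regWeight n ε := by
  have := one_le_precision ε
  unfold regWeight
  positivity

/-- The factor $(n+1)^2$ in the weight absorbs the logarithm of the number of tours. -/
theorem regWeight_mul_log_card_le (hε : 0 < ε) :
    regWeight n ε * Real.log (Fintype.card (Tour n)) ≤ ε / 8 := by
  have h1 := log_card_tour_le n
  have h2 := inv_precision_le hε
  have h3 := one_le_precision ε
  calc _ ≤ regWeight n ε * ((n : ℝ) + 1) ^ 2 :=
        mul_le_mul_of_nonneg_left h1 (regWeight_pos n ε).le
    _ = (precision ε : ℝ)⁻¹ / 8 := by unfold regWeight; field_simp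
    _ ≤ _ := by linarith

/-- The parameter whose Gibbs measures minimize the regularized loss. -/
def optParam {n : ℕ} (lam : ℝ) (M : Mat n) : Param n :=
  WithLp.toLp 2 fun p => if p.1 = p.2 then -(M p.1 / lam) else 0

variable {n}

theorem cost_eq_score_optParam {lam : ℝ} (hlam : lam ≠ 0) (M E : Mat n) (σ : Tour n) :
    cost M E σ = -(lam * score (optParam lam M) E σ) := by
  simp only [cost, score, optParam, mul_ite, mul_zero, ite_mul, zero_mul, Finset.sum_ite_eq,
    Finset.mem_univ, if_true]
  rw [Finset.mul_sum, ← Finset.sum_neg_distrib]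
  refine Finset.sum_congr rfl fun a _ => ?_
  field_simp

theorem norm_optParam {lam : ℝ} (hlam : 0 < lam) (M : Mat n) :
    ‖optParam lam M‖ = ‖M‖ / lam := by
  have h : ‖optParam lam M‖ ^ 2 = (‖M‖ / lam) ^ 2 := by
    rw [EuclideanSpace.norm_sq_eq, div_pow, EuclideanSpace.norm_sq_eq, Finset.sum_div,
      Fintype.sum_prod_type]
    refine Finset.sum_congr rfl fun a _ => ?_
    rw [Finset.sum_eq_single a]
    · simp [optParam, div_pow]
    · intro b _ hb
      simp [optParam, hb.symm]
    · simp
  exact (sq_eq_sq₀ (norm_nonneg _) (by positivity)).1 h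

/-- The radius is the norm bound divided by $\lambda$; the added $1$ keeps it positive for $K=0$. -/
theorem norm_optParam_le {M : Mat n} (hM : ‖M‖ ≤ normBound K n) :
    ‖optParam (regWeight n ε) M‖ ≤ radius K n ε := by
  rw [norm_optParam (regWeight_pos n ε), regWeight, div_inv_eq_mul]
  calc _ ≤ (normBound K n : ℝ) * (8 * ((n : ℝ) + 1) ^ 2 * precision ε) := by gcongr
    _ ≤ _ := by unfold radius; push_cast; linarith

variable (n)

theorem sampleBound_le (ε : ℝ) :
    sampleBound n (regWeight n ε) (radius K n ε) (normBound K n) ≤ sampleSize K n ε := by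
  have h1 := log_card_tour_le n
  have h2 : regWeight n ε ≤ 1 := by
    have h3 := one_le_precision ε
    have h4 : 1 ≤ ((n : ℝ) + 1) ^ 2 :=
      one_le_pow₀ (by linarith [(Nat.cast_nonneg n : (0 : ℝ) ≤ n)])
    refine inv_le_one_of_one_le₀ ?_
    nlinarith
  have hT : (1 : ℝ) ≤ Fintype.card (Tour n) := by
    exact_mod_cast Nat.succ_le_of_lt Fintype.card_pos
  have hl := Real.log_nonneg hT
  unfold sampleBound sampleSize
  push_cast
  calc _ ≤ 1 * (((n : ℝ) + 1) ^ 2 + 3 * (radius K n ε * (normBound K n * (n + 1)))) *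
        (2 * (normBound K n * (n + 1))) := by gcongr
    _ = _ := by ring

theorem four_le_invScale (ε : ℝ) : 4 ≤ invScale K n ε := by
  have h1 : 1 ≤ radius K n ε := Nat.le_add_left _ _
  calc 4 = 4 * 1 * 1 * 1 := rfl
    _ ≤ _ := by unfold invScale; gcongr <;> omega

/-- This choice of $\rho$ keeps all slow scores below $1/4$ on the whole parameter ball. -/
theorem inv_invScale_mul_le (ε : ℝ) :
    (invScale K n ε : ℝ)⁻¹ * (radius K n ε * (normBound K n * (n + 1))) ≤ 1 / 4 := by
  have h : (4 : ℝ) ≤ invScale K n ε := by exact_mod_cast four_le_invScale K n ε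
  rw [inv_mul_le_iff₀ (by linarith)]
  have h0 : (0 : ℝ) ≤ radius K n ε * (n + 1) := by positivity
  unfold invScale
  push_cast
  linarith

theorem identifiedByBits_radius (hε : 0 < ε) {β ρ : ℝ} (hβ0 : 0 ≤ β) (hβ1 : β ≤ 1)
    (hρ0 : 0 ≤ ρ) (hρ1 : ρ ≤ 1) :
    IdentifiedByBits n β ρ (radius K n ε) (normBound K n) ε
      (n * n * (n * n) * Nat.size (2 * radius K n ε * gridSize K n ε)) := by
  have hm := one_le_precision ε
  have hmε := inv_precision_le hε
  have hn : (0 : ℝ) ≤ n := Nat.cast_nonneg n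
  have hD : (0 : ℝ) ≤ normBound K n := Nat.cast_nonneg _
  have hg : (0 : ℝ) < gridSize K n ε := by unfold gridSize; push_cast; positivity
  have hkey : (n : ℝ) ^ 2 * (gridSize K n ε : ℝ)⁻¹ * ((normBound K n + 1) * (n + 1)) ≤
      (precision ε : ℝ)⁻¹ / 4 := by
    have h1 : (n : ℝ) ^ 2 * (gridSize K n ε : ℝ)⁻¹ * ((normBound K n + 1) * (n + 1)) =
        (n : ℝ) ^ 2 / (n + 1) ^ 2 * ((precision ε : ℝ)⁻¹ / 4) := by
      unfold gridSize; push_cast; field_simp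
    rw [h1]
    refine mul_le_of_le_one_left (by positivity) ((div_le_one (by positivity)).2 ?_)
    gcongr
    linarith
  have hh : 0 ≤ (n : ℝ) ^ 2 * (gridSize K n ε : ℝ)⁻¹ := by positivity
  have hu : (n : ℝ) ^ 2 * (gridSize K n ε : ℝ)⁻¹ * (normBound K n * (n + 1)) ≤
      (precision ε : ℝ)⁻¹ / 4 := by
    refine le_trans ?_ hkey
    gcongr
    linarith
  have hh' : (n : ℝ) ^ 2 * (gridSize K n ε : ℝ)⁻¹ ≤ (precision ε : ℝ)⁻¹ / 4 := by
    refine le_trans (le_mul_of_one_le_right hh ?_) hkey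
    exact one_le_mul_of_one_le_of_one_le (by linarith) (by linarith)
  have hinv : (precision ε : ℝ)⁻¹ ≤ 1 := inv_le_one_of_one_le₀ hm
  refine identifiedByBits hβ0 hβ1 hρ0 hρ1 (Nat.cast_nonneg _) hD (inv_pos.2 hg)
    (by linarith) (by linarith) (by linarith) ?_
  rw [div_inv_eq_mul]
  exact_mod_cast Nat.lt_size_self (2 * radius K n ε * gridSize K n ε)

theorem steps_suffice (hε : 0 < ε) {V : ℝ} (hV : 0 ≤ V) {T : ℕ}
    (hT : ⌈stepBound K n ε V⌉₊ + 1 ≤ T) :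
    4 * (radius K n ε : ℝ) ^ 2 * ((sampleSize K n ε : ℝ) ^ 2 + V + 1) ≤
      ((invQuasar K n ε : ℝ)⁻¹ * (ε / 2)) ^ 2 * T := by
  have h1 : stepBound K n ε V ≤ T := (Nat.le_ceil _).trans (by exact_mod_cast (by omega))
  have hm := one_le_precision ε
  have hmε := inv_precision_le hε
  have h4 := four_le_invScale K n ε
  have hq : (0 : ℝ) < invQuasar K n ε := by
    have : 0 < invQuasar K n ε := by unfold invQuasar; positivity
    exact_mod_cast this
  have h2 : 1 ≤ ((invQuasar K n ε : ℝ)⁻¹ * (ε / 2)) * (invQuasar K n ε * (2 * precision ε)) := by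
    have h3 : ((invQuasar K n ε : ℝ)⁻¹ * (ε / 2)) * (invQuasar K n ε * (2 * precision ε)) =
        ε * precision ε := by field_simp
    rw [h3]
    calc (1 : ℝ) = (precision ε : ℝ)⁻¹ * precision ε := by field_simp
      _ ≤ _ := by gcongr
  calc _ ≤ 4 * (radius K n ε : ℝ) ^ 2 * ((sampleSize K n ε : ℝ) ^ 2 + V + 1) *
        (((invQuasar K n ε : ℝ)⁻¹ * (ε / 2)) * (invQuasar K n ε * (2 * precision ε))) ^ 2 :=
        le_mul_of_one_le_right (by positivity) (one_le_pow₀ h2)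
    _ = ((invQuasar K n ε : ℝ)⁻¹ * (ε / 2)) ^ 2 * stepBound K n ε V := by
        unfold stepBound; ring
    _ ≤ _ := by gcongr

end Parameters

end TSPGenerator

end

/-! ### Convergence for the chosen parameters, and the theorem. -/

noncomputable section

namespace TSPGenerator

open scoped RealInnerProductSpace

theorem mul_pow_mul_pow_mono {c d : ℕ} {p q : ℝ} (hp : 1 ≤ p) (hq : 1 ≤ q) (hcd : c ≤ d) :
    (c : ℝ) * p ^ c * q ^ c ≤ d * p ^ d * q ^ d := by
  gcongr

theorem mul_pow_mul_pow_mul_pow_mono {c d : ℕ} {p q r : ℝ} (hp : 1 ≤ p) (hq : 1 ≤ q)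
    (hr : 1 ≤ r) (hcd : c ≤ d) :
    (c : ℝ) * p ^ c * q ^ c * r ^ c ≤ d * p ^ d * q ^ d * r ^ d := by
  gcongr

/-- Projected SGD on the regularized loss converges. -/
theorem sgd_converges (K n : ℕ) {ε : ℝ} (hε : 0 < ε) {M : Mat n} (hM : ‖M‖ ≤ normBound K n)
    {μ : Measure (Mat n)} [IsProbabilityMeasure μ] (hμ : ∀ᵐ E ∂μ, ‖E‖ ≤ normBound K n) {β ρ : ℝ}
    (hβ : β = (invScale K n ε : ℝ)⁻¹) (hρ : ρ = (invScale K n ε : ℝ)⁻¹) {V : ℝ} (hV : 0 ≤ V)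
    (κ : Kernel (Param n) (Param n)) [IsMarkovKernel κ]
    (hκ : IsGradientOracle κ (regLoss μ M β ρ (regWeight n ε)) (radius K n ε) V)
    {W₀ : Param n} (hW₀ : ‖W₀‖ ≤ radius K n ε) {T : ℕ}
    (hT : ⌈stepBound K n ε V⌉₊ + 1 ≤ T) :
    sgdValue κ ((invQuasar K n ε : ℝ)⁻¹ * (ε / 2) / ((sampleSize K n ε : ℝ) ^ 2 + V + 1))
      (radius K n ε) W₀ T (regLoss μ M β ρ (regWeight n ε)) ≤
      regLoss μ M β ρ (regWeight n ε) (optParam (regWeight n ε) M) + ε / 2 := by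
  have hr : (4 : ℝ) ≤ invScale K n ε := by exact_mod_cast four_le_invScale K n ε
  have hi0 : 0 < (invScale K n ε : ℝ)⁻¹ := inv_pos.2 (by linarith)
  have hi1 : (invScale K n ε : ℝ)⁻¹ ≤ 1 := inv_le_one_of_one_le₀ (by linarith)
  have hβ0 : 0 < β := hβ ▸ hi0
  have hβ1 : β ≤ 1 := hβ ▸ hi1
  have hρ0 : 0 < ρ := hρ ▸ hi0
  have hρ1 : ρ ≤ 1 := hρ ▸ hi1
  have hlam := regWeight_pos n ε
  have hcost := cost_eq_score_optParam hlam.ne' M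
  have hWbar := norm_optParam_le (ε := ε) K hM
  have hq : (0 : ℝ) < invQuasar K n ε := by
    have h4 := four_le_invScale K n ε
    have : 0 < invQuasar K n ε := by unfold invQuasar; positivity
    exact_mod_cast this
  refine sgdValue_le κ hκ hV hWbar (hasGradientAt_regLoss hμ M β ρ _)
    (fun W hW => (norm_gradient_le hμ hlam hρ0 hρ1 hβ0.le hβ1 hcost hWbar hW).trans
      (sampleBound_le K n ε)) (inv_pos.2 hq) (fun W hW => ?_) hW₀ (half_pos hε) (by omega)
    (steps_suffice K n hε hV hT)
  have h := regLoss_sub_le hμ hlam hρ0 hρ1 hβ0 hβ1 hcost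
    (hρ ▸ inv_invScale_mul_le K n ε) hW
  rw [inv_mul_le_iff₀ hq]
  have h5 : (invQuasar K n ε : ℝ) = 8 * ((n : ℝ) + 1) ^ 8 * (invScale K n ε : ℝ) ^ 2 := by
    unfold invQuasar; push_cast; ring
  rw [hβ, hρ] at h ⊢
  rw [h5]
  -- Since $\beta\rho$ is the inverse square of `invScale`, this clears the left side and builds
  -- `invQuasar` on the right.
  have h6 := mul_le_mul_of_nonneg_left h (sq_nonneg (invScale K n ε : ℝ))
  calc _ = (invScale K n ε : ℝ) ^ 2 * ((invScale K n ε : ℝ)⁻¹ * (invScale K n ε : ℝ)⁻¹ * _) := by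
        field_simp
    _ ≤ _ := h6
    _ = _ := by ring

end TSPGenerator

end

theorem mainTheorem7 (K : ℕ) :
    ∃ c : ℕ, ∀ (n : ℕ) (ε : ℝ), 0 < ε →
      ∃ (β ρ B : ℚ) (lam : ℝ),
        0 < β ∧ β < 1 ∧ 0 < ρ ∧ ρ < 1 ∧ 0 < B ∧ 0 < lam ∧
        -- compressed
        (∃ N : ℕ,
          ((N + TSPGenerator.ratBits β + TSPGenerator.ratBits ρ + TSPGenerator.ratBits B : ℕ) : ℝ)
            ≤ c * ((n : ℝ) + 1) ^ c * (1 + Real.log (1 + 1 / ε)) ^ c ∧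
          TSPGenerator.IdentifiedByBits n β ρ B (K * ((n : ℝ) + 1) ^ K) ε N) ∧
        ∀ (M : TSPGenerator.Mat n), ‖M‖ ≤ K * ((n : ℝ) + 1) ^ K →
        ∀ (μ : MeasureTheory.Measure (TSPGenerator.Mat n)),
          MeasureTheory.IsProbabilityMeasure μ →
          (∀ᵐ E ∂μ, ‖E‖ ≤ K * ((n : ℝ) + 1) ^ K) →
          ∃ Wbar ∈ Metric.closedBall (0 : TSPGenerator.Param n) (B : ℝ),
            -- complete
            TSPGenerator.loss μ M β ρ Wbar ≤ TSPGenerator.opt μ M + ε ∧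
            -- policy gradient estimates are unbiased, with polynomially bounded variance
            (∃ (V : ℝ) (κ : ProbabilityTheory.Kernel (TSPGenerator.Param n)
                (TSPGenerator.Param n)),
              V ≤ c * ((n : ℝ) + 1) ^ c * (1 + 1 / ε) ^ c ∧
              ProbabilityTheory.IsMarkovKernel κ ∧
              (∀ W, κ W = TSPGenerator.policyGradientLaw μ M β ρ lam W) ∧
              TSPGenerator.IsGradientOracle κ (TSPGenerator.regLoss μ M β ρ lam) B V) ∧
            -- projected SGD on the regularized loss converges in polynomially many steps
            (∀ V : ℝ, 0 ≤ V →
              ∃ (η : ℝ) (T₀ : ℕ), 0 < η ∧ 0 < T₀ ∧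
                (T₀ : ℝ) ≤ c * ((n : ℝ) + 1) ^ c * (1 + 1 / ε) ^ c * (1 + V) ^ c ∧
                ∀ (κ : ProbabilityTheory.Kernel (TSPGenerator.Param n) (TSPGenerator.Param n)),
                  ProbabilityTheory.IsMarkovKernel κ →
                  TSPGenerator.IsGradientOracle κ (TSPGenerator.regLoss μ M β ρ lam) B V →
                  ∀ W₀ ∈ Metric.closedBall (0 : TSPGenerator.Param n) (B : ℝ),
                  ∀ T : ℕ, T₀ ≤ T →
                    (∀ W ∈ Metric.closedBall (0 : TSPGenerator.Param n) (B : ℝ),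
                      TSPGenerator.sgdValue κ η B W₀ T (TSPGenerator.regLoss μ M β ρ lam)
                        ≤ TSPGenerator.regLoss μ M β ρ lam W + ε) ∧
                    TSPGenerator.sgdValue κ η B W₀ T (TSPGenerator.loss μ M β ρ)
                      ≤ TSPGenerator.loss μ M β ρ Wbar + ε) := by
  obtain ⟨c₁, hc₁⟩ := TSPGenerator.Setting.exists_bits_bound K
  obtain ⟨c₂, hc₂⟩ := TSPGenerator.Setting.exists_variance_bound K
  obtain ⟨c₃, hc₃⟩ := TSPGenerator.Setting.exists_steps_bound K
  refine ⟨c₁ + c₂ + c₃, fun n ε hε => ?_⟩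
  have hn1 : 1 ≤ (n : ℝ) + 1 := by linarith [(Nat.cast_nonneg n : (0 : ℝ) ≤ n)]
  have hε1 : 1 ≤ 1 + 1 / ε := by linarith [one_div_pos.2 hε]
  have hlog1 : 1 ≤ 1 + Real.log (1 + 1 / ε) := by linarith [Real.log_nonneg hε1]
  have hr4 : (4 : ℚ) ≤ TSPGenerator.invScale K n ε := by
    exact_mod_cast TSPGenerator.four_le_invScale K n ε
  have hi0 : 0 < (TSPGenerator.invScale K n ε : ℚ)⁻¹ := inv_pos.2 (by linarith)
  have hi1 : (TSPGenerator.invScale K n ε : ℚ)⁻¹ < 1 := inv_lt_one_of_one_lt₀ (by linarith)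
  have hB : (0 : ℚ) < TSPGenerator.radius K n ε := by
    unfold TSPGenerator.radius; positivity
  have hlam := TSPGenerator.regWeight_pos n ε
  have hentropy := TSPGenerator.regWeight_mul_log_card_le n hε
  have hD : (K : ℝ) * ((n : ℝ) + 1) ^ K = TSPGenerator.normBound K n := by
    unfold TSPGenerator.normBound; push_cast; ring
  have hBcast : (((TSPGenerator.radius K n ε : ℕ) : ℚ) : ℝ) = TSPGenerator.radius K n ε :=
    Rat.cast_natCast _
  rw [hD]
  -- Taking $\beta=\rho$ makes $\beta/\rho=1$, so the slow entropy costs no more than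
  -- $\lambda\log\#\mathrm{tours}$.
  refine ⟨(TSPGenerator.invScale K n ε : ℚ)⁻¹, (TSPGenerator.invScale K n ε : ℚ)⁻¹,
    TSPGenerator.radius K n ε, TSPGenerator.regWeight n ε, hi0, hi1, hi0, hi1, hB, hlam, ?_⟩
  have hscale : (((TSPGenerator.invScale K n ε : ℚ)⁻¹ : ℚ) : ℝ) =
      (TSPGenerator.invScale K n ε : ℝ)⁻¹ := by push_cast; rfl
  have hρ0 : 0 < (((TSPGenerator.invScale K n ε : ℚ)⁻¹ : ℚ) : ℝ) := by exact_mod_cast hi0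
  have hρ1 : (((TSPGenerator.invScale K n ε : ℚ)⁻¹ : ℚ) : ℝ) ≤ 1 := by exact_mod_cast hi1.le
  rw [hBcast]
  generalize (((TSPGenerator.invScale K n ε : ℚ)⁻¹ : ℚ) : ℝ) = ρ at hscale hρ0 hρ1 ⊢
  refine ⟨⟨_, (hc₁ n ε hε).trans
      (TSPGenerator.mul_pow_mul_pow_mono hn1 hlog1 (by omega)),
    TSPGenerator.identifiedByBits_radius K n hε hρ0.le hρ1 hρ0.le hρ1⟩, ?_⟩
  intro M hM μ hμp hμ
  have hcost := TSPGenerator.cost_eq_score_optParam hlam.ne' M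
  have hWbar := TSPGenerator.norm_optParam_le (ε := ε) K hM
  have hslack : TSPGenerator.regWeight n ε * (1 - ρ + ρ / ρ) *
      Real.log (Fintype.card (TSPGenerator.Tour n)) ≤ ε / 2 := by
    rw [div_self hρ0.ne']
    have hT : (1 : ℝ) ≤ Fintype.card (TSPGenerator.Tour n) := by
      exact_mod_cast Nat.succ_le_of_lt Fintype.card_pos
    have h := mul_nonneg hlam.le (Real.log_nonneg hT)
    nlinarith
  refine ⟨TSPGenerator.optParam (TSPGenerator.regWeight n ε) M,
    mem_closedBall_zero_iff.2 hWbar, ?_, ?_, ?_⟩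
  · have h := TSPGenerator.loss_opt_le hμ hlam hρ0 hρ0.le hρ1 hcost
    linarith
  · refine ⟨_, TSPGenerator.policyKernel μ M ρ ρ (TSPGenerator.regWeight n ε), ?_,
      TSPGenerator.isMarkovKernel_policyKernel μ hρ0.le hρ1 M, fun W => rfl,
      TSPGenerator.isGradientOracle_policyKernel hμ hlam hρ0 hρ1 hρ0.le hρ1 hcost hWbar⟩
    refine le_trans ?_ ((hc₂ n ε hε).trans
      (TSPGenerator.mul_pow_mul_pow_mono hn1 hε1 (by omega)))
    have h0 : 0 ≤ TSPGenerator.sampleBound n (TSPGenerator.regWeight n ε)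
        (TSPGenerator.radius K n ε) (TSPGenerator.normBound K n) :=
      (norm_nonneg _).trans (TSPGenerator.norm_gradient_le (β := ρ) hμ hlam hρ0 hρ1 hρ0.le hρ1
        hcost hWbar hWbar)
    have h := TSPGenerator.sampleBound_le K n ε
    gcongr
  · intro V hV
    have hq : (0 : ℝ) < TSPGenerator.invQuasar K n ε := by
      have h4 := TSPGenerator.four_le_invScale K n ε
      have : 0 < TSPGenerator.invQuasar K n ε := by
        unfold TSPGenerator.invQuasar; positivity
      exact_mod_cast this
    refine ⟨(TSPGenerator.invQuasar K n ε : ℝ)⁻¹ * (ε / 2) /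
        ((TSPGenerator.sampleSize K n ε : ℝ) ^ 2 + V + 1),
      ⌈TSPGenerator.stepBound K n ε V⌉₊ + 1, by positivity, Nat.succ_pos _,
      (hc₃ n ε V hε hV).trans (TSPGenerator.mul_pow_mul_pow_mul_pow_mono hn1 hε1
        (by linarith) (by omega)), ?_⟩
    intro κ hκm hκ W₀ hW₀ T hT
    have hW₀' := mem_closedBall_zero_iff.1 hW₀
    have hmain := TSPGenerator.sgd_converges K n hε hM hμ hscale hscale hV κ hκ hW₀' hT
    refine ⟨fun W _ => hmain.trans ?_, ?_⟩
    · have h := TSPGenerator.regLoss_opt_le hμ hlam hρ0 hρ0.le hρ1 hcost W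
      linarith
    -- The constant `C` is loss minus regularized loss at $\overline W$ plus the entropy slack
    -- $\epsilon/2$; the other $\epsilon/2$ is the SGD error.
    · have hmono := TSPGenerator.sgdValue_mono κ
        (η := (TSPGenerator.invQuasar K n ε : ℝ)⁻¹ * (ε / 2) /
          ((TSPGenerator.sampleSize K n ε : ℝ) ^ 2 + V + 1)) hW₀'
        (TSPGenerator.continuous_loss hμ M ρ ρ)
        (TSPGenerator.continuous_regLoss hμ M ρ ρ (TSPGenerator.regWeight n ε))
        (C := TSPGenerator.loss μ M ρ ρ
            (TSPGenerator.optParam (TSPGenerator.regWeight n ε) M) -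
          TSPGenerator.regLoss μ M ρ ρ (TSPGenerator.regWeight n ε)
            (TSPGenerator.optParam (TSPGenerator.regWeight n ε) M) + ε / 2)
        (fun W => by
          have h := TSPGenerator.loss_sub_le (μ := μ) hlam hρ0 hρ0.le hρ1 M W
            (TSPGenerator.optParam (TSPGenerator.regWeight n ε) M)
          linarith) (T := T) (by omega)
      linarith
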